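/- Let $\mathcal X,\Theta,\mathcal Y$ be Hilbert spaces (all real or all complex) and $T>0$. Let $A$ be a skew-adjoint operator on $\mathcal X$ ($A$ densely defined, $A^*=-A$), the generator of the strongly continuous group $(e^{At})_{t\in\mathbb R}$. Let $C\in\mathcal L(\mathcal X,\mathcal Y)$, $B\in L^2(0,T;\mathcal L(\Theta,\mathcal X))$, $y\in L^2(0,T;\mathcal Y)$, $\theta_0\in\Theta$, and let $U_0\in\mathcal L(\Theta)$ be self-adjoint with $U_0\ge\delta I$ for some $\delta>0$. Assume exact observability at time $T$: there is $\gamma>0$ with $\int_0^T\|Ce^{At}x\|_{\mathcal Y}^2\,dt\ge\gamma^2\|x\|_{\mathcal X}^2$ for all $x\in\mathcal X$. Let $\kappa_j\ge 0$ $(j\ge1)$ satisfy $\sum_{j=1}^\infty\kappa_j=\infty$ and $\sum_{j=1}^\infty\kappa_j^2<\infty$, and put $K_j=\kappa_jC^*$. Differential equations below are understood in the mild sense on $[0,T]$ (those for operators strongly or weakly, i.e. applied to, respectively tested against, fixed vectors). Given initial guesses $\hat z_0^-(T)\in\mathcal X$ and $\hat\theta_1\in\Theta$, the method computes for $j=1,2,\dots$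 $$\begin{cases}\dot{\hat z}_j^+=A\hat z_j^++K_j(y-C\hat z_j^+)+B\hat\theta_j,& \hat z_j^+(0)=\hat z_{j-1}^-(T),\\ \dot\Pi_j=(A-K_jC)\Pi_j+B,& \Pi_j(0)=0,\\ \dot U=\Pi_j^*C^*C\Pi_j,& U(0)=U_0,\\ \dot\xi=\Pi_j^*C^*(y-C\hat z_j^+),& \xi(0)=0,\\ \hat\theta_{j+1}=\hat\theta_j-U(T)^{-1}\big(U_0(\hat\theta_j-\theta_0)-\xi(T)\big),\end{cases}$$ $$\begin{cases}\dot{\hat z}_j^-(t)=-A\hat z_j^-(t)+K_j\big(y(T-t)-C\hat z_j^-(t)\big)-B(T-t)\hat\theta_{j+1},\\ \hat z_j^-(0)=\hat z_j^+(T)+\Pi_j(T)(\hat\theta_{j+1}-\hat\theta_j).\end{cases}$$ Consider the open-loop cost $$J(\zeta,\xi)=\langle\xi-\theta_0,U_0(\xi-\theta_0)\rangle_\Theta+\int_0^T\|y-C\hat z[\zeta,\xi]\|_{\mathcal Y}^2\,dt,\qquad (\zeta,\xi)\in\mathcal X\times\Theta,$$ where $\dot{\hat z}[\zeta,\xi]=A\hat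 z[\zeta,\xi]+B\xi$, $\hat z[\zeta,\xi](0)=\zeta$. Then $J$ has a unique minimizer $(\zeta^o,\theta^o)$, and for every choice of initial guesses the iterates of the method exist and $\hat z_j^-(T)\to\zeta^o$ in $\mathcal X$ and $\hat\theta_j\to\theta^o$ in $\Theta$, in norm, as $j\to\infty$. -/

import Mathlib

open MeasureTheory Filter Topology

/-- A strongly continuous group of bounded linear operators on `X`, written `t ↦ e^{tA}`,
with `A` its `generator` below. -/
structure C0Group (𝕜 X : Type*) [RCLike 𝕜] [NormedAddCommGroup X] [InnerProductSpace 𝕜 X] where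
  /-- The operator at time `t`. -/
  op : ℝ → X →L[𝕜] X
  op_zero : op 0 = ContinuousLinearMap.id 𝕜 X
  op_add : ∀ s t : ℝ, op (s + t) = (op s).comp (op t)
  continuous_orbit : ∀ x : X, Continuous fun t => op t x

namespace C0Group

variable {𝕜 X : Type*} [RCLike 𝕜] [NormedAddCommGroup X] [InnerProductSpace 𝕜 X]
  [NormedSpace ℝ X] [IsScalarTower ℝ 𝕜 X]

/-- The infinitesimal generator: its domain is the set of all `x` whose orbit is differentiable
at time `0`, and its value at `x` is that derivative. -/
noncomputable def generator (S : C0Group 𝕜 X) : X →ₗ.[𝕜] X where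
  domain :=
    { carrier := {x | DifferentiableAt ℝ (fun t => S.op t x) 0}
      zero_mem' := by
        simp
      add_mem' := by
        intro x y hx hy
        have hx' : DifferentiableAt ℝ (fun t => S.op t x) 0 := hx
        have hy' : DifferentiableAt ℝ (fun t => S.op t y) 0 := hy
        simpa using hx'.fun_add hy'
      smul_mem' := by
        intro c x hx
        have hx' : DifferentiableAt ℝ (fun t => S.op t x) 0 := hx
        have : SMulCommClass ℝ 𝕜 X := inferInstance
        simpa using hx'.fun_const_smul c }
  toFun :=
    { toFun := fun x => deriv (fun t => S.op t (x : X)) 0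
      map_add' := by
        rintro ⟨x, hx⟩ ⟨y, hy⟩
        have hx' : DifferentiableAt ℝ (fun t => S.op t x) 0 := hx
        have hy' : DifferentiableAt ℝ (fun t => S.op t y) 0 := hy
        simpa using deriv_fun_add hx' hy'
      map_smul' := by
        rintro c ⟨x, hx⟩
        have hx' : DifferentiableAt ℝ (fun t => S.op t x) 0 := hx
        simpa using deriv_fun_const_smul c hx' }

end C0Group

/-- A densely defined operator `A` on a Hilbert space is skew-adjoint if `A* = -A`
(equality of domains included). -/
def IsSkewAdjointOperator {𝕜 X : Type*} [RCLike 𝕜] [NormedAddCommGroup X] [InnerProductSpace 𝕜 X]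
    [CompleteSpace X] (A : X →ₗ.[𝕜] X) : Prop :=
  Dense (A.domain : Set X) ∧ A.adjoint = -A

/-- `z` is the mild solution on `[0, T]` of `ż = G z + f`, `z(0) = x₀`, where `E t = e^{tG}`. -/
def IsMildSolution {𝕜 X : Type*} [RCLike 𝕜] [NormedAddCommGroup X] [InnerProductSpace 𝕜 X]
    [NormedSpace ℝ X] (E : ℝ → X →L[𝕜] X) (T : ℝ) (f : ℝ → X) (x₀ : X) (z : ℝ → X) : Prop :=
  ContinuousOn z (Set.Icc 0 T) ∧ IntegrableOn f (Set.Icc 0 T) ∧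
    ∀ t ∈ Set.Icc 0 T, z t = E t x₀ + ∫ s in (0 : ℝ)..t, E (t - s) (f s)

/-- The data of a linear source estimation problem for `ż = A z + B θ`, `y = C z` on `[0, T]`. -/
structure SourceProblem (𝕜 X Θ Y : Type*) [RCLike 𝕜]
    [NormedAddCommGroup X] [InnerProductSpace 𝕜 X]
    [NormedAddCommGroup Θ] [InnerProductSpace 𝕜 Θ]
    [NormedAddCommGroup Y] [InnerProductSpace 𝕜 Y] where
  /-- The group `e^{tA}`. -/
  S : C0Group 𝕜 X
  /-- The final time. -/
  T : ℝ
  /-- The time-dependent source operator. -/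
  B : ℝ → Θ →L[𝕜] X
  /-- The observation operator. -/
  C : X →L[𝕜] Y
  /-- The measured output. -/
  y : ℝ → Y
  /-- The regularization operator. -/
  U₀ : Θ →L[𝕜] Θ
  /-- The prior parameter. -/
  θ₀ : Θ

namespace SourceProblem

variable {𝕜 X Θ Y : Type*} [RCLike 𝕜]
  [NormedAddCommGroup X] [InnerProductSpace 𝕜 X]
  [NormedAddCommGroup Θ] [InnerProductSpace 𝕜 Θ]
  [NormedAddCommGroup Y] [InnerProductSpace 𝕜 Y]

/-- Exact observability at time `T`. -/
def ExactlyObservable (p : SourceProblem 𝕜 X Θ Y) : Prop :=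
  ∃ γ : ℝ, 0 < γ ∧ ∀ x : X, γ ^ 2 * ‖x‖ ^ 2 ≤ ∫ t in (0 : ℝ)..p.T, ‖p.C (p.S.op t x)‖ ^ 2

/-- The open-loop trajectory: the mild solution of `ż = A z + B ξ`, `z(0) = ζ`. -/
noncomputable def openLoop [NormedSpace ℝ X] (p : SourceProblem 𝕜 X Θ Y) (ζ : X) (ξ : Θ)
    (t : ℝ) : X :=
  p.S.op t ζ + ∫ s in (0 : ℝ)..t, p.S.op (t - s) (p.B s ξ)

/-- The open-loop regularized output-error cost. -/
noncomputable def cost [NormedSpace ℝ X] (p : SourceProblem 𝕜 X Θ Y) (ζ : X) (ξ : Θ) : ℝ :=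
  RCLike.re (inner 𝕜 (ξ - p.θ₀) (p.U₀ (ξ - p.θ₀))) +
    ∫ t in (0 : ℝ)..p.T, ‖p.y t - p.C (p.openLoop ζ ξ t)‖ ^ 2

/-- `(ζ, ξ)` minimizes the open-loop cost over `X × Θ`. -/
def IsMinimizer [NormedSpace ℝ X] (p : SourceProblem 𝕜 X Θ Y) (ζ : X) (ξ : Θ) : Prop :=
  ∀ (ζ' : X) (ξ' : Θ), p.cost ζ ξ ≤ p.cost ζ' ξ'

/-- The iterations `j = 1, 2, …` of the estimation method with gains `κ j` and colocated feedback
`K_j = κ_j C*`, started from the initial-state guess `ζinit` and the parameter guess `θinit`.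
All trajectories matter on `[0, T]` only. -/
structure Run [NormedSpace ℝ X] [CompleteSpace X] [CompleteSpace Y]
    (p : SourceProblem 𝕜 X Θ Y) (κ : ℕ → ℝ) (ζinit : X) (θinit : Θ) where
  /-- Forward observers. -/
  zPlus : ℕ → ℝ → X
  /-- Backward observers; `zMinus j p.T` is the initial-state estimate after `j` iterations. -/
  zMinus : ℕ → ℝ → X
  /-- Parameter estimates. -/
  θ : ℕ → Θ
  /-- Sensitivity operators `Π_j(t)`. -/
  sens : ℕ → ℝ → Θ →L[𝕜] X
  /-- The operators `U(t)` of each iteration. -/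
  U : ℕ → ℝ → Θ →L[𝕜] Θ
  /-- The vectors `ξ(t)` of each iteration. -/
  ξ : ℕ → ℝ → Θ
  zMinus_init : zMinus 0 p.T = ζinit
  θ_init : θ 1 = θinit
  /-- `ẑ_j⁺' = A ẑ_j⁺ + K_j (y - C ẑ_j⁺) + B θ̂_j`, `ẑ_j⁺(0) = ẑ_{j-1}⁻(T)`. -/
  forward : ∀ j, 1 ≤ j → IsMildSolution p.S.op p.T
    (fun t => (κ j : 𝕜) • p.C.adjoint (p.y t - p.C (zPlus j t)) + p.B t (θ j))
    (zMinus (j - 1) p.T) (zPlus j)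
  /-- `Π_j' = (A - K_j C) Π_j + B`, `Π_j(0) = 0`, applied to each vector `η` of the
  parameter space. -/
  sensitivity : ∀ j, 1 ≤ j → ∀ η : Θ, IsMildSolution p.S.op p.T
    (fun t => -((κ j : 𝕜) • p.C.adjoint (p.C (sens j t η))) + p.B t η) 0 (fun t => sens j t η)
  /-- `U' = (C Π_j)* C Π_j`, `U(0) = U₀`: the integrated equation, tested against pairs of
  vectors. -/
  U_eq : ∀ j, 1 ≤ j → ∀ t ∈ Set.Icc 0 p.T, ∀ η η' : Θ,
    inner 𝕜 η (U j t η') = inner 𝕜 η (p.U₀ η') +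
      ∫ s in (0 : ℝ)..t, inner 𝕜 (p.C (sens j s η)) (p.C (sens j s η'))
  /-- `ξ' = (C Π_j)* (y - C ẑ_j⁺)`, `ξ(0) = 0`: the integrated equation, tested against
  vectors. -/
  ξ_eq : ∀ j, 1 ≤ j → ∀ t ∈ Set.Icc 0 p.T, ∀ η : Θ,
    inner 𝕜 η (ξ j t) =
      ∫ s in (0 : ℝ)..t, inner 𝕜 (p.C (sens j s η)) (p.y s - p.C (zPlus j s))
  /-- `θ̂_{j+1} = θ̂_j - U(T)⁻¹ (U₀ (θ̂_j - θ₀) - ξ(T))`. -/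
  θ_step : ∀ j, 1 ≤ j →
    θ (j + 1) = θ j - (U j p.T).inverse (p.U₀ (θ j - p.θ₀) - ξ j p.T)
  /-- `ẑ_j⁻'(t) = -A ẑ_j⁻(t) + K_j (y(T-t) - C ẑ_j⁻(t)) - B(T-t) θ̂_{j+1}`,
  `ẑ_j⁻(0) = ẑ_j⁺(T) + Π_j(T) (θ̂_{j+1} - θ̂_j)`; the operator `-A` generates `e^{-tA}`. -/
  backward : ∀ j, 1 ≤ j → IsMildSolution (fun t => p.S.op (-t)) p.T
    (fun t => (κ j : 𝕜) • p.C.adjoint (p.y (p.T - t) - p.C (zMinus j t))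
      - p.B (p.T - t) (θ (j + 1)))
    (zPlus j p.T + sens j p.T (θ (j + 1) - θ j)) (zMinus j)

end SourceProblem

/-! Since A is skew-adjoint, e^{tA} is unitary (`C0Group.norm_op_of_isSkewAdjoint`), so multiplying
every trajectory by e^{-tA} loses nothing and removes A from the equations. In this moving frame the
open-loop state is ζ + β(t)ξ with β(t) = ∫₀ᵗ e^{-sA}B(s) ds, and its output is D(t)(ζ + β(t)ξ) with
D(t) = C e^{tA}. Thus J is a quadratic least-squares functional. Observability and U₀ ≥ δ make its
quadratic part coercive with some constant α > 0 (`exists_coercive`); the normal equations are then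
solvable (`exists_normalEquations`), and J grows quadratically around their solution
(`NormalEquations.cost_add`), which is the unique minimizer.

For the iteration, let d, d' be the initial-state errors before and after one sweep, φ the error of
the updated parameter and e the residual at the minimizer. Correcting the forward observer by Π
times the parameter increment gives the observer driven by the new parameter, so both half-sweeps
have errors d + βφ + O(κ) (`SourceProblem.Run.isIterationError`). As ∫D*e = 0 by the normal
equations, d' = d - 2κ ∫D*D(d + βφ) + O(κ²), while the parameter update gives ⟨φ, U₀φ⟩ + ∫⟨Dβφ, D(d
+ βφ)⟩ = O(κ). The two relations together say that, in real parts, ⟨d, ∫D*D(d + βφ)⟩ = ∫‖D(d + βφ)‖²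
+ ⟨φ, U₀φ⟩ + O(κ) ≥ α(‖d‖² + ‖φ‖²) + O(κ), the O terms growing with d and φ. One sweep is therefore
approximately a gradient step of size κ for J minimized over the parameter.

For small κ this yields ‖d'‖² ≤ (1 - rκ)‖d‖² + Kκ² and ‖φ‖ ≤ K(‖d‖ + κ)
(`exists_iteration_estimate`). The conditions ∑κ_j = ∞ and ∑κ_j² < ∞ force ‖d‖ → 0
(`tendsto_zero_of_contraction`), and the parameter error follows. -/

set_option linter.unusedSectionVars false

/-! ### Strongly continuous operator families -/

/-- A strongly continuous, uniformly bounded family of operators is jointly continuous. -/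
theorem continuous_uncurry_of_strong {𝕜 E F : Type*} [RCLike 𝕜] [NormedAddCommGroup E]
    [NormedSpace 𝕜 E] [NormedAddCommGroup F] [NormedSpace 𝕜 F] {K : ℝ → E →L[𝕜] F} {c : ℝ}
    (hK : ∀ x, Continuous fun t => K t x) (hc : ∀ t, ‖K t‖ ≤ c) :
    Continuous (Function.uncurry fun t x => K t x) := by
  have h : Continuous fun q : E × ℝ => K q.2 q.1 :=
    continuous_prod_of_continuous_lipschitzWith _ c.toNNReal hK fun t =>
      (K t).lipschitz.weaken <| by
        rw [← norm_toNNReal]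
        exact Real.toNNReal_le_toNNReal (hc t)
  exact h.comp continuous_swap

/-- Applying a jointly continuous bounded family to an integrable function. -/
theorem integrable_strong_apply {𝕜 E F : Type*} [RCLike 𝕜] [NormedAddCommGroup E]
    [NormedSpace 𝕜 E] [NormedAddCommGroup F] [NormedSpace 𝕜 F] {K : ℝ → E →L[𝕜] F} {c : ℝ}
    (hK : ∀ x, Continuous fun t => K t x) (hc : ∀ t, ‖K t‖ ≤ c) {μ : Measure ℝ} {f : ℝ → E}
    (hf : Integrable f μ) : Integrable (fun t => K t (f t)) μ := by
  refine (hf.norm.const_mul c).mono'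
    ((continuous_uncurry_of_strong hK hc).comp_aestronglyMeasurable₂
      continuous_id.aestronglyMeasurable hf.1) (ae_of_all _ fun t => ?_)
  exact ((K t).le_opNorm _).trans (by gcongr; exact hc t)

theorem intervalIntegrable_strong_apply {𝕜 E F : Type*} [RCLike 𝕜] [NormedAddCommGroup E]
    [NormedSpace 𝕜 E] [NormedAddCommGroup F] [NormedSpace 𝕜 F] {K : ℝ → E →L[𝕜] F} {c : ℝ}
    (hK : ∀ x, Continuous fun t => K t x) (hc : ∀ t, ‖K t‖ ≤ c) {a b : ℝ} {f : ℝ → E}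
    (hf : IntervalIntegrable f volume a b) :
    IntervalIntegrable (fun t => K t (f t)) volume a b :=
  ⟨integrable_strong_apply hK hc hf.1, integrable_strong_apply hK hc hf.2⟩

theorem ContinuousOn.strong_apply {𝕜 E F : Type*} [RCLike 𝕜] [NormedAddCommGroup E]
    [NormedSpace 𝕜 E] [NormedAddCommGroup F] [NormedSpace 𝕜 F] {K : ℝ → E →L[𝕜] F} {c : ℝ}
    (hK : ∀ x, Continuous fun t => K t x) (hc : ∀ t, ‖K t‖ ≤ c) {s : Set ℝ} {f : ℝ → E}
    (hf : ContinuousOn f s) : ContinuousOn (fun t => K t (f t)) s :=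
  (continuous_uncurry_of_strong hK hc).comp_continuousOn (continuousOn_id.prodMk hf)

/-! ### Unitary groups and the moving frame -/

namespace C0Group

variable {𝕜 X : Type*} [RCLike 𝕜] [NormedAddCommGroup X] [InnerProductSpace 𝕜 X]

theorem op_op (S : C0Group 𝕜 X) (s t : ℝ) (x : X) : S.op s (S.op t x) = S.op (s + t) x := by
  rw [S.op_add]; rfl

theorem op_zero_apply (S : C0Group 𝕜 X) (x : X) : S.op 0 x = x := by
  rw [S.op_zero]; rfl

theorem op_neg_op (S : C0Group 𝕜 X) (t : ℝ) (x : X) : S.op (-t) (S.op t x) = x := by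
  rw [op_op, neg_add_cancel, op_zero_apply]

theorem op_op_neg (S : C0Group 𝕜 X) (t : ℝ) (x : X) : S.op t (S.op (-t) x) = x := by
  rw [op_op, add_neg_cancel, op_zero_apply]

/-- The group run backwards in time. -/
def reverse (S : C0Group 𝕜 X) : C0Group 𝕜 X where
  op t := S.op (-t)
  op_zero := by rw [neg_zero, S.op_zero]
  op_add s t := by rw [neg_add, S.op_add]
  continuous_orbit x := (S.continuous_orbit x).comp continuous_neg

section generator

variable [NormedSpace ℝ X] [IsScalarTower ℝ 𝕜 X]

theorem hasDerivAt_op (S : C0Group 𝕜 X) {x : X} (hx : x ∈ S.generator.domain) (t : ℝ) :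
    HasDerivAt (fun s => S.op s x) (S.op t (S.generator ⟨x, hx⟩)) t := by
  have h0 : HasDerivAt (fun s => S.op s x) (S.generator ⟨x, hx⟩) (t - t) := by
    rw [sub_self]
    exact DifferentiableAt.hasDerivAt (show DifferentiableAt ℝ (fun s => S.op s x) 0 from hx)
  have h1 : HasDerivAt (fun s => S.op (s - t) x) (S.generator ⟨x, hx⟩) t := by
    simpa using h0.comp_sub_const t t
  have h2 := (((S.op t).restrictScalars ℝ).hasFDerivAt.comp_hasDerivAt t h1)
  refine h2.congr_of_eventuallyEq (Eventually.of_forall fun s => ?_)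
  simp [op_op]

theorem op_mem_domain (S : C0Group 𝕜 X) {x : X} (hx : x ∈ S.generator.domain) (t : ℝ) :
    ∃ h : S.op t x ∈ S.generator.domain,
      S.generator ⟨S.op t x, h⟩ = S.op t (S.generator ⟨x, hx⟩) := by
  have h1 : HasDerivAt (fun s => S.op s (S.op t x)) (S.op t (S.generator ⟨x, hx⟩)) 0 := by
    have h0 : HasDerivAt (fun s => S.op s x) (S.op t (S.generator ⟨x, hx⟩)) (0 + t) := by
      rw [zero_add]; exact S.hasDerivAt_op hx t
    refine (h0.comp_add_const 0 t).congr_of_eventuallyEq (Eventually.of_forall fun s => ?_)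
    simp [op_op]
  exact ⟨h1.differentiableAt, h1.deriv⟩

/-- A group with a skew-adjoint generator is isometric. -/
theorem norm_op_of_isSkewAdjoint [CompleteSpace X] (S : C0Group 𝕜 X)
    (hA : IsSkewAdjointOperator S.generator) (t : ℝ) (x : X) : ‖S.op t x‖ = ‖x‖ := by
  obtain ⟨hd, hadj⟩ := hA
  -- A* = -A makes this sum vanish. It is the derivative of ‖S.op s x‖² along orbits in the domain;
  -- density handles the remaining vectors.
  have skew : ∀ z : S.generator.domain,
      inner 𝕜 (z : X) (S.generator z) + inner 𝕜 (S.generator z) (z : X) = 0 := by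
    intro z
    have hfa := LinearPMap.adjoint_isFormalAdjoint hd
    rw [hadj] at hfa
    have := hfa ⟨z, z.2⟩ z
    rw [LinearPMap.neg_apply] at this
    rw [← this, inner_neg_left]
    exact neg_add_cancel _
  have key : ∀ x ∈ (S.generator.domain : Set X), ‖S.op t x‖ = ‖x‖ := by
    intro x hx
    have hder : ∀ s, HasDerivAt (fun s => inner 𝕜 (S.op s x) (S.op s x)) (0 : 𝕜) s := by
      intro s
      obtain ⟨hm, he⟩ := S.op_mem_domain hx s
      have h := (S.hasDerivAt_op hx s).inner 𝕜 (S.hasDerivAt_op hx s)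
      rw [← he] at h
      have := skew ⟨S.op s x, hm⟩
      rwa [this] at h
    have hc := is_const_of_deriv_eq_zero (𝕜 := ℝ) (fun s => (hder s).differentiableAt)
      (fun s => (hder s).deriv) t 0
    simp only [op_zero_apply, inner_self_eq_norm_sq_to_K] at hc
    have : ‖S.op t x‖ ^ 2 = ‖x‖ ^ 2 := by exact_mod_cast hc
    exact (pow_left_inj₀ (norm_nonneg _) (norm_nonneg _) two_ne_zero).1 this
  have hcl : IsClosed {x : X | ‖S.op t x‖ = ‖x‖} :=
    isClosed_eq (S.op t).continuous.norm continuous_norm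
  exact hcl.closure_subset_iff.2 key (hd x)

end generator

theorem norm_op_le (S : C0Group 𝕜 X) (hS : ∀ t x, ‖S.op t x‖ = ‖x‖) (t : ℝ) : ‖S.op t‖ ≤ 1 :=
  (S.op t).opNorm_le_bound zero_le_one fun x => by rw [hS, one_mul]

/-- An isometry has its adjoint as left inverse, and the group law supplies a two-sided inverse. -/
theorem adjoint_op [CompleteSpace X] (S : C0Group 𝕜 X) (hS : ∀ t x, ‖S.op t x‖ = ‖x‖) (t : ℝ) :
    (S.op t).adjoint = S.op (-t) := by
  have h := ((S.op t).norm_map_iff_adjoint_comp_self).1 (hS t)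
  ext x
  have := DFunLike.congr_fun h (S.op (-t) x)
  simpa [op_op_neg] using this

/-- Mild solutions of an isometric group, seen in the moving frame. -/
theorem isMildSolution_iff [CompleteSpace X] [NormedSpace ℝ X] (S : C0Group 𝕜 X)
    (hS : ∀ t x, ‖S.op t x‖ = ‖x‖) {T : ℝ} (hT : 0 ≤ T) {f z : ℝ → X} {x₀ : X}
    (hz : ContinuousOn z (Set.Icc 0 T)) (hf : IntegrableOn f (Set.Icc 0 T)) :
    IsMildSolution S.op T f x₀ z ↔
      ∀ t ∈ Set.Icc 0 T, S.op (-t) (z t) = x₀ + ∫ s in (0 : ℝ)..t, S.op (-s) (f s) := by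
  have hfi : IntervalIntegrable f volume 0 T :=
    (intervalIntegrable_iff_integrableOn_Icc_of_le hT).2 hf
  -- The factorization e^{(t-s)A} = e^{tA}e^{-sA} takes e^{tA} out of the integral.
  have key : ∀ t ∈ Set.Icc 0 T,
      S.op t x₀ + ∫ s in (0 : ℝ)..t, S.op (t - s) (f s) =
        S.op t (x₀ + ∫ s in (0 : ℝ)..t, S.op (-s) (f s)) := by
    intro t ht
    have hi : IntervalIntegrable (fun s => S.op (-s) (f s)) volume 0 t :=
      (intervalIntegrable_strong_apply (S.reverse.continuous_orbit)
        (fun t => S.norm_op_le hS (-t)) hfi).mono_set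
        (by rw [Set.uIcc_of_le ht.1, Set.uIcc_of_le hT]; exact Set.Icc_subset_Icc_right ht.2)
    rw [map_add, ← ContinuousLinearMap.intervalIntegral_comp_comm _ hi]
    simp_rw [op_op, sub_eq_add_neg]
  constructor
  · rintro ⟨-, -, h⟩ t ht
    rw [h t ht, key t ht, op_neg_op]
  · intro h
    refine ⟨hz, hf, fun t ht => ?_⟩
    rw [key t ht, ← h t ht, op_op_neg]

end C0Group

/-! ### Volterra integral equations -/

section Volterra

variable {𝕜 X : Type*} [RCLike 𝕜] [NormedAddCommGroup X] [InnerProductSpace 𝕜 X]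
  [NormedSpace ℝ X] [CompleteSpace X] {T : ℝ}

/-- The primitive of an integrable function, as a continuous path. -/
noncomputable def primitivePath (T : ℝ) (f : ℝ → X) (hf : IntegrableOn f (Set.Icc 0 T)) :
    C(Set.Icc (0 : ℝ) T, X) where
  toFun t := ∫ s in (0 : ℝ)..t, f s
  continuous_toFun := by
    rcases le_or_gt 0 T with hT | hT
    · have h := intervalIntegral.continuousOn_primitive_interval (a := 0) (b := T) (f := f)
        (μ := volume) (by rwa [Set.uIcc_of_le hT])
      rw [Set.uIcc_of_le hT] at h
      exact h.domRestrict
    · have : IsEmpty (Set.Icc (0 : ℝ) T) := by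
        rw [Set.Icc_eq_empty_of_lt hT]; infer_instance
      exact continuous_of_const fun t => this.elim t

theorem primitivePath_apply {f : ℝ → X} (hf : IntegrableOn f (Set.Icc 0 T))
    (t : Set.Icc (0 : ℝ) T) : primitivePath T f hf t = ∫ s in (0 : ℝ)..t, f s := rfl

theorem continuous_strong_IccExtend (hT : 0 ≤ T) {K : ℝ → X →L[𝕜] X} {c : ℝ}
    (hK : ∀ x, Continuous fun t => K t x) (hc : ∀ t, ‖K t‖ ≤ c) (u : C(Set.Icc (0 : ℝ) T, X)) :
    Continuous fun s => K s (Set.IccExtend hT u s) :=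
  (continuous_uncurry_of_strong hK hc).comp
    (continuous_id.prodMk (u.continuous.Icc_extend' (h := hT)))

theorem norm_volterra_le [SMulCommClass ℝ 𝕜 X] (hT : 0 ≤ T) {K : ℝ → X →L[𝕜] X} {c : ℝ}
    (hc : ∀ t, ‖K t‖ ≤ c) (u : C(Set.Icc (0 : ℝ) T, X)) {g : ℝ → ℝ} (hg : Continuous g)
    (hu : ∀ t : Set.Icc (0 : ℝ) T, ‖u t‖ ≤ g t) (t : Set.Icc (0 : ℝ) T) :
    ‖∫ s in (0 : ℝ)..t, K s (Set.IccExtend hT u s)‖ ≤ ∫ s in (0 : ℝ)..t, c * g s := by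
  refine intervalIntegral.norm_integral_le_of_norm_le t.2.1 (ae_of_all _ fun s hs => ?_)
    ((continuous_const.mul hg).intervalIntegrable _ _)
  have hs' : s ∈ Set.Icc 0 T := ⟨hs.1.le, hs.2.trans t.2.2⟩
  rw [Set.IccExtend_of_mem hT _ hs']
  exact ((K s).le_opNorm _).trans
    (mul_le_mul (hc s) (hu ⟨s, hs'⟩) (norm_nonneg _) ((norm_nonneg _).trans (hc s)))

/-- The Volterra operator `u ↦ ∫₀ᵗ K(s) u(s) ds` on continuous paths. -/
noncomputable def volterra (hT : 0 ≤ T) (K : ℝ → X →L[𝕜] X) (c : ℝ)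
    (hK : ∀ x, Continuous fun t => K t x) (hc : ∀ t, ‖K t‖ ≤ c) [SMulCommClass ℝ 𝕜 X] :
    C(Set.Icc (0 : ℝ) T, X) →L[𝕜] C(Set.Icc (0 : ℝ) T, X) :=
  LinearMap.mkContinuous
    { toFun := fun u => primitivePath T (fun s => K s (Set.IccExtend hT u s))
        (continuous_strong_IccExtend hT hK hc u).integrableOn_Icc
      map_add' := fun u v => by
        ext t
        simp only [primitivePath_apply, ContinuousMap.add_apply]
        rw [← intervalIntegral.integral_add
          ((continuous_strong_IccExtend hT hK hc u).intervalIntegrable _ _)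
          ((continuous_strong_IccExtend hT hK hc v).intervalIntegrable _ _)]
        simp [Set.IccExtend]
      map_smul' := fun a u => by
        ext t
        simp only [primitivePath_apply, ContinuousMap.smul_apply, RingHom.id_apply]
        rw [← intervalIntegral.integral_smul]
        simp [Set.IccExtend] }
    (c * T) fun u => by
      have hc0 : 0 ≤ c := (norm_nonneg _).trans (hc 0)
      refine (ContinuousMap.norm_le _ (by positivity)).2 fun t => ?_
      refine (norm_volterra_le hT hc u (g := fun _ => ‖u‖) continuous_const
        (fun t => u.norm_coe_le_norm t) t).trans ?_
      rw [intervalIntegral.integral_const, smul_eq_mul, sub_zero]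
      have := mul_le_mul_of_nonneg_right t.2.2 (mul_nonneg hc0 (norm_nonneg u))
      linarith

theorem volterra_apply [SMulCommClass ℝ 𝕜 X] (hT : 0 ≤ T) (K : ℝ → X →L[𝕜] X) (c : ℝ)
    (hK : ∀ x, Continuous fun t => K t x) (hc : ∀ t, ‖K t‖ ≤ c) (u : C(Set.Icc (0 : ℝ) T, X))
    (t : Set.Icc (0 : ℝ) T) :
    volterra hT K c hK hc u t = ∫ s in (0 : ℝ)..t, K s (Set.IccExtend hT u s) := rfl

/-- Each application integrates the previous bound (c s)ⁿ/n! once more. -/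
theorem norm_volterra_pow_apply_le [SMulCommClass ℝ 𝕜 X] (hT : 0 ≤ T) (K : ℝ → X →L[𝕜] X)
    (c : ℝ) (hK : ∀ x, Continuous fun t => K t x) (hc : ∀ t, ‖K t‖ ≤ c)
    (u : C(Set.Icc (0 : ℝ) T, X)) (n : ℕ) (t : Set.Icc (0 : ℝ) T) :
    ‖(volterra hT K c hK hc ^ n) u t‖ ≤ (c * t) ^ n / n.factorial * ‖u‖ := by
  induction n generalizing t with
  | zero => simpa using u.norm_coe_le_norm t
  | succ n ih =>
    rw [pow_succ']
    change ‖volterra hT K c hK hc ((volterra hT K c hK hc ^ n) u) t‖ ≤ _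
    rw [volterra_apply]
    refine (norm_volterra_le hT hc _ (g := fun s => (c * s) ^ n / n.factorial * ‖u‖)
      (by fun_prop) ih t).trans (le_of_eq ?_)
    have : ∀ s : ℝ, c * ((c * s) ^ n / n.factorial * ‖u‖) =
        (c ^ (n + 1) / n.factorial * ‖u‖) * s ^ n := by
      intro s; rw [mul_pow, pow_succ]; ring
    simp_rw [this]
    rw [intervalIntegral.integral_const_mul, integral_pow, Nat.factorial_succ, mul_pow]
    push_cast
    field_simp
    ring

/-- V may have large norm, but some power has norm below 1 by the factorial bound. Then 1 - Vⁿ is a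
unit, and 1 - V is one of its two commuting factors in the geometric sum identity. -/
theorem isUnit_one_sub_volterra [SMulCommClass ℝ 𝕜 X] (hT : 0 ≤ T) (K : ℝ → X →L[𝕜] X)
    (c : ℝ) (hK : ∀ x, Continuous fun t => K t x) (hc : ∀ t, ‖K t‖ ≤ c) :
    IsUnit (1 - volterra hT K c hK hc) := by
  set V := volterra hT K c hK hc
  have hc0 : 0 ≤ c := (norm_nonneg _).trans (hc 0)
  obtain ⟨n, hn⟩ := ((FloorSemiring.tendsto_pow_div_factorial_atTop (c * T)).eventually
    (gt_mem_nhds zero_lt_one)).exists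
  have hV : ‖V ^ n‖ ≤ (c * T) ^ n / n.factorial := by
    refine ContinuousLinearMap.opNorm_le_bound _ (by positivity) fun u => ?_
    refine (ContinuousMap.norm_le _ (by positivity)).2 fun t => ?_
    refine (norm_volterra_pow_apply_le hT K c hK hc u n t).trans ?_
    have h1 : 0 ≤ c * (t : ℝ) := mul_nonneg hc0 t.2.1
    have h2 : c * (t : ℝ) ≤ c * T := mul_le_mul_of_nonneg_left t.2.2 hc0
    gcongr
  have hu : IsUnit (1 - V ^ n) := isUnit_one_sub_of_norm_lt_one
    (R := C(Set.Icc (0 : ℝ) T, X) →L[𝕜] C(Set.Icc (0 : ℝ) T, X)) (hV.trans_lt hn)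
  rw [← mul_neg_geom_sum] at hu
  refine ((Commute.isUnit_mul_iff ?_).1 hu).1
  exact (mul_neg_geom_sum V n).trans (geom_sum_mul_neg V n).symm

/-- Solution operator of the linear Volterra equation `u = h + ∫₀ᵗ K(s) u(s) ds`. -/
theorem exists_volterra_resolvent [SMulCommClass ℝ 𝕜 X] (hT : 0 ≤ T) (K : ℝ → X →L[𝕜] X)
    (c : ℝ) (hK : ∀ x, Continuous fun t => K t x) (hc : ∀ t, ‖K t‖ ≤ c) :
    ∃ R : C(Set.Icc (0 : ℝ) T, X) →L[𝕜] C(Set.Icc (0 : ℝ) T, X),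
      ∀ h t, R h t = h t + ∫ s in (0 : ℝ)..t, K s (Set.IccExtend hT (R h) s) := by
  obtain ⟨R, hR, -⟩ := isUnit_iff_exists.1 (isUnit_one_sub_volterra hT K c hK hc)
  refine ⟨R, fun h t => ?_⟩
  have := DFunLike.congr_fun (DFunLike.congr_fun hR h) t
  rw [← volterra_apply hT K c hK hc]
  have h2 : R h t - volterra hT K c hK hc (R h) t = h t := this
  rw [← h2, sub_add_cancel]

end Volterra

/-! ### Bounded perturbations of the group -/

section Perturbation

variable {𝕜 X : Type*} [RCLike 𝕜] [NormedAddCommGroup X] [InnerProductSpace 𝕜 X]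
  [NormedSpace ℝ X] [CompleteSpace X] {T : ℝ}

theorem C0Group.integrableOn_op_neg (S : C0Group 𝕜 X) (hS : ∀ t x, ‖S.op t x‖ = ‖x‖)
    {f : ℝ → X} {s : Set ℝ} (hf : IntegrableOn f s) :
    IntegrableOn (fun t => S.op (-t) (f t)) s :=
  integrable_strong_apply (S.reverse.continuous_orbit) (fun t => S.norm_op_le hS (-t)) hf

/-- Solution operator of `ż = A z + L z + F`, `z(0) = x₀`, with `L` bounded, acting on the path
`x₀ + ∫₀ᵗ e^{-sA} F(s) ds`. -/
theorem C0Group.exists_perturbed_mild (S : C0Group 𝕜 X) (hS : ∀ t x, ‖S.op t x‖ = ‖x‖)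
    [SMulCommClass ℝ 𝕜 X] (hT : 0 ≤ T) (L : X →L[𝕜] X) :
    ∃ R : C(Set.Icc (0 : ℝ) T, X) →L[𝕜] C(Set.Icc (0 : ℝ) T, X),
      ∀ (F : ℝ → X) (x₀ : X) (h : C(Set.Icc (0 : ℝ) T, X)), IntegrableOn F (Set.Icc 0 T) →
        (∀ t, h t = x₀ + ∫ s in (0 : ℝ)..t, S.op (-s) (F s)) →
        ∀ z : ℝ → X, (∀ t, z t = S.op t (Set.IccExtend hT (R h) t)) →
          IsMildSolution S.op T (fun t => L (z t) + F t) x₀ z := by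
  have hS1 := S.norm_op_le hS
  have hcont : ∀ x, Continuous fun s => L (S.op s x) := fun x =>
    L.continuous.comp (S.continuous_orbit x)
  -- In the moving frame L becomes e^{-sA} L e^{sA}, still bounded by ‖L‖. The resolvent R depends
  -- on neither the source nor the initial value, so the sensitivity can later be built as a bounded
  -- operator.
  obtain ⟨R, hR⟩ := exists_volterra_resolvent (T := T) hT
    (fun s => (S.op (-s)).comp (L.comp (S.op s))) ‖L‖
    (fun x => (continuous_uncurry_of_strong S.reverse.continuous_orbit
      (fun t => hS1 (-t))).comp (continuous_id.prodMk (hcont x)))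
    (fun t => ContinuousLinearMap.opNorm_le_bound _ (norm_nonneg _) fun x => by
      change ‖S.op (-t) (L (S.op t x))‖ ≤ _
      rw [hS, ← hS t x]
      exact L.le_opNorm _)
  refine ⟨R, fun F x₀ h hF hh z hz' => ?_⟩
  obtain rfl : z = _ := funext hz'
  set u := R h with hu
  have hz : Continuous fun t => S.op t (Set.IccExtend hT u t) :=
    continuous_strong_IccExtend hT S.continuous_orbit hS1 u
  have hLz : Continuous fun t => L (S.op t (Set.IccExtend hT u t)) := L.continuous.comp hz
  refine (S.isMildSolution_iff hS hT hz.continuousOn (hLz.integrableOn_Icc.add hF)).2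
    fun t ht => ?_
  rw [op_neg_op, Set.IccExtend_of_mem hT _ ht]
  have hFt : IntervalIntegrable (fun s => S.op (-s) (F s)) volume 0 t :=
    ((intervalIntegrable_iff_integrableOn_Icc_of_le hT).2 (S.integrableOn_op_neg hS hF)).mono_set
      (by rw [Set.uIcc_of_le ht.1, Set.uIcc_of_le hT]; exact Set.Icc_subset_Icc_right ht.2)
  have hLt : IntervalIntegrable (fun s => S.op (-s) (L (S.op s (Set.IccExtend hT u s))))
      volume 0 t :=
    intervalIntegrable_strong_apply S.reverse.continuous_orbit (fun t => hS1 (-t))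
      (hLz.intervalIntegrable _ _)
  have hsum : ∫ s in (0 : ℝ)..t, S.op (-s) (L (S.op s (Set.IccExtend hT u s)) + F s) =
      (∫ s in (0 : ℝ)..t, S.op (-s) (L (S.op s (Set.IccExtend hT u s)))) +
        ∫ s in (0 : ℝ)..t, S.op (-s) (F s) := by
    simp only [map_add]
    exact intervalIntegral.integral_add hLt hFt
  refine Eq.trans ?_ (congrArg (x₀ + ·) hsum.symm)
  rw [hR h ⟨t, ht⟩, ← hu, hh]
  simp only [ContinuousLinearMap.comp_apply]
  abel

end Perturbation

/-! ### Riesz representation of integrated forms -/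

section Riesz

variable {𝕜 H Y : Type*} [RCLike 𝕜] [NormedAddCommGroup H] [InnerProductSpace 𝕜 H]
  [NormedAddCommGroup Y] [InnerProductSpace 𝕜 Y] {T : ℝ}

theorem integrableOn_inner_of_continuousOn {u f : ℝ → Y} (hu : ContinuousOn u (Set.Icc 0 T))
    (hf : IntegrableOn f (Set.Icc 0 T)) :
    IntegrableOn (fun s => inner 𝕜 (u s) (f s)) (Set.Icc 0 T) := by
  obtain ⟨M, hM⟩ := isCompact_Icc.exists_bound_of_continuousOn hu
  refine (hf.norm.const_mul M).mono'
    ((hu.aestronglyMeasurable measurableSet_Icc).inner hf.1) ?_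
  filter_upwards [ae_restrict_mem measurableSet_Icc] with s hs
  exact (norm_inner_le_norm _ _).trans (by gcongr; exact hM s hs)

theorem integrableOn_inner_right_of_continuousOn {u f : ℝ → Y} (hu : ContinuousOn u (Set.Icc 0 T))
    (hf : IntegrableOn f (Set.Icc 0 T)) :
    IntegrableOn (fun s => inner 𝕜 (f s) (u s)) (Set.Icc 0 T) := by
  obtain ⟨M, hM⟩ := isCompact_Icc.exists_bound_of_continuousOn hu
  refine (hf.norm.mul_const M).mono'
    (hf.1.inner (hu.aestronglyMeasurable measurableSet_Icc)) ?_
  filter_upwards [ae_restrict_mem measurableSet_Icc] with s hs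
  exact (norm_inner_le_norm _ _).trans (by gcongr; exact hM s hs)

theorem intervalIntegrable_of_mem_Icc {E : Type*} [NormedAddCommGroup E] {f : ℝ → E}
    (hf : IntegrableOn f (Set.Icc 0 T)) {a b : ℝ} (ha : a ∈ Set.Icc 0 T) (hb : b ∈ Set.Icc 0 T) :
    IntervalIntegrable f volume a b :=
  ((intervalIntegrable_iff_integrableOn_Icc_of_le (ha.1.trans ha.2)).2 hf).mono_set <| by
    rw [Set.uIcc_of_le (ha.1.trans ha.2)]
    exact Set.uIcc_subset_Icc ha hb

theorem intervalIntegrable_inner_of_continuousOn {u f : ℝ → Y}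
    (hu : ContinuousOn u (Set.Icc 0 T)) (hf : IntegrableOn f (Set.Icc 0 T)) {a b : ℝ}
    (ha : a ∈ Set.Icc 0 T) (hb : b ∈ Set.Icc 0 T) :
    IntervalIntegrable (fun s => inner 𝕜 (u s) (f s)) volume a b :=
  intervalIntegrable_of_mem_Icc (integrableOn_inner_of_continuousOn hu hf) ha hb

/-- Riesz representation of `η ↦ ∫₀ᵗ ⟨Φ(s) η, f(s)⟩ ds`. -/
theorem exists_inner_eq_integral [CompleteSpace H] {Φ : ℝ → H →L[𝕜] Y} {M : ℝ}
    (hΦ : ∀ η, ContinuousOn (fun s => Φ s η) (Set.Icc 0 T))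
    (hM : ∀ s ∈ Set.Icc 0 T, ∀ η, ‖Φ s η‖ ≤ M * ‖η‖) {f : ℝ → Y}
    (hf : IntegrableOn f (Set.Icc 0 T)) {t : ℝ} (ht : t ∈ Set.Icc 0 T) :
    ∃ n : H, ∀ η, inner 𝕜 η n = ∫ s in (0 : ℝ)..t, inner 𝕜 (Φ s η) (f s) := by
  have h0 : (0 : ℝ) ∈ Set.Icc 0 T := ⟨le_rfl, ht.1.trans ht.2⟩
  have hi := fun η => intervalIntegrable_inner_of_continuousOn (𝕜 := 𝕜) (hΦ η) hf h0 ht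
  have hi' : ∀ η, IntervalIntegrable (fun s => inner 𝕜 (f s) (Φ s η)) volume 0 t := by
    intro η
    refine intervalIntegrable_of_mem_Icc ?_ h0 ht
    exact integrableOn_inner_right_of_continuousOn (hΦ η) hf
  have hfn : IntervalIntegrable (fun s => M * ‖f s‖) volume 0 t :=
    (intervalIntegrable_of_mem_Icc hf h0 ht).norm.const_mul M
  -- The target functional is conjugate-linear in η, so Riesz is applied to its conjugate.
  let φ : H →L[𝕜] 𝕜 := LinearMap.mkContinuous
    { toFun := fun η => ∫ s in (0 : ℝ)..t, inner 𝕜 (f s) (Φ s η)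
      map_add' := fun η η' => by
        simp only [map_add, inner_add_right]
        exact intervalIntegral.integral_add (hi' η) (hi' η')
      map_smul' := fun a η => by
        simp only [map_smul, inner_smul_right, RingHom.id_apply, smul_eq_mul]
        exact intervalIntegral.integral_const_mul _ _ }
    (∫ s in (0 : ℝ)..t, M * ‖f s‖) fun η => by
      change ‖∫ s in (0 : ℝ)..t, inner 𝕜 (f s) (Φ s η)‖ ≤ _
      rw [← intervalIntegral.integral_mul_const]
      refine intervalIntegral.norm_integral_le_of_norm_le ht.1 (ae_of_all _ fun s hs => ?_)
        (hfn.mul_const _)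
      refine (norm_inner_le_norm _ _).trans ?_
      have := hM s ⟨hs.1.le, hs.2.trans ht.2⟩ η
      calc ‖f s‖ * ‖Φ s η‖ ≤ ‖f s‖ * (M * ‖η‖) := by gcongr
        _ = M * ‖f s‖ * ‖η‖ := by ring
  refine ⟨(InnerProductSpace.toDual 𝕜 H).symm φ, fun η => ?_⟩
  rw [← inner_conj_symm, InnerProductSpace.toDual_symm_apply]
  change (starRingEnd 𝕜) (∫ s in (0 : ℝ)..t, inner 𝕜 (f s) (Φ s η)) = _
  rw [← intervalIntegral.intervalIntegral_conj]
  simp only [inner_conj_symm]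

/-- The operator with the form `(η, η') ↦ ∫₀ᵗ ⟨Φ(s) η, Φ(s) η'⟩ ds`. -/
theorem exists_gramian [CompleteSpace H] (hT : 0 ≤ T) {Φ : ℝ → H →L[𝕜] Y} {M : ℝ} (hM0 : 0 ≤ M)
    (hΦ : ∀ η, ContinuousOn (fun s => Φ s η) (Set.Icc 0 T))
    (hM : ∀ s ∈ Set.Icc 0 T, ∀ η, ‖Φ s η‖ ≤ M * ‖η‖) {t : ℝ} (ht : t ∈ Set.Icc 0 T) :
    ∃ N : H →L[𝕜] H, ∀ η η',
      inner 𝕜 η (N η') = ∫ s in (0 : ℝ)..t, inner 𝕜 (Φ s η) (Φ s η') := by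
  have h0 : (0 : ℝ) ∈ Set.Icc 0 T := ⟨le_rfl, hT⟩
  choose n hn using fun η' => exists_inner_eq_integral hΦ hM (hΦ η').integrableOn_Icc ht
  have hi := fun η η' => intervalIntegrable_inner_of_continuousOn (𝕜 := 𝕜) (hΦ η)
    (hΦ η').integrableOn_Icc h0 ht
  refine ⟨LinearMap.mkContinuous ⟨⟨n, fun a b => ?_⟩, fun a b => ?_⟩ (M * M * T)
    fun η' => ?_, fun η η' => hn η' η⟩
  · refine ext_inner_left 𝕜 fun η => ?_
    rw [inner_add_right, hn, hn, hn]
    simp only [map_add, inner_add_right]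
    exact intervalIntegral.integral_add (hi _ _) (hi _ _)
  · refine ext_inner_left 𝕜 fun η => ?_
    simp only [RingHom.id_apply]
    rw [inner_smul_right, hn, hn]
    simp only [map_smul, inner_smul_right]
    exact intervalIntegral.integral_const_mul _ _
  · change ‖n η'‖ ≤ _
    -- Testing the form against n η' itself bounds ‖n η'‖²; one factor is then cancelled.
    have h1 : ‖n η'‖ * ‖n η'‖ ≤ (M * M * T * ‖η'‖) * ‖n η'‖ := by
      rw [← inner_self_eq_norm_mul_norm (𝕜 := 𝕜)]
      refine (RCLike.re_le_norm _).trans ?_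
      rw [hn]
      refine (intervalIntegral.norm_integral_le_of_norm_le_const
        (C := M * ‖n η'‖ * (M * ‖η'‖)) fun s hs => ?_).trans ?_
      · rw [Set.uIoc_of_le ht.1] at hs
        have hs' : s ∈ Set.Icc 0 T := ⟨hs.1.le, hs.2.trans ht.2⟩
        exact (norm_inner_le_norm _ _).trans
          (mul_le_mul (hM s hs' _) (hM s hs' _) (norm_nonneg _) (by positivity))
      · rw [sub_zero, abs_of_nonneg ht.1]
        have := mul_le_mul_of_nonneg_left ht.2
          (show 0 ≤ M * ‖n η'‖ * (M * ‖η'‖) by positivity)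
        linarith
    rcases (norm_nonneg (n η')).eq_or_lt with h | h
    · rw [← h]; positivity
    · exact le_of_mul_le_mul_right h1 h

end Riesz

/-! ### Abstract least squares: coercivity, normal equations, cost -/

/-- A bounded family of observation operators, strongly continuous together with its adjoints. -/
structure IsObservedFamily {𝕜 X Y : Type*} [RCLike 𝕜] [NormedAddCommGroup X]
    [InnerProductSpace 𝕜 X] [CompleteSpace X] [NormedAddCommGroup Y] [InnerProductSpace 𝕜 Y]
    [CompleteSpace Y] (D : ℝ → X →L[𝕜] Y) (c : ℝ) : Prop where
  cont : ∀ x, Continuous fun t => D t x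
  cont_adjoint : ∀ y, Continuous fun t => (D t).adjoint y
  norm_le : ∀ t, ‖D t‖ ≤ c

/-- A bounded, strongly continuous family of operators. -/
structure IsStrongFamily {𝕜 E F : Type*} [RCLike 𝕜] [NormedAddCommGroup E]
    [NormedSpace 𝕜 E] [NormedAddCommGroup F] [NormedSpace 𝕜 F] (K : ℝ → E →L[𝕜] F) (m : ℝ) :
    Prop where
  cont : ∀ x, Continuous fun t => K t x
  norm_le : ∀ t, ‖K t‖ ≤ m

section LeastSquares

variable {𝕜 X Θ Y : Type*} [RCLike 𝕜]
  [NormedAddCommGroup X] [InnerProductSpace 𝕜 X] [CompleteSpace X]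
  [NormedAddCommGroup Θ] [InnerProductSpace 𝕜 Θ] [CompleteSpace Θ]
  [NormedAddCommGroup Y] [InnerProductSpace 𝕜 Y] [CompleteSpace Y]
  {D : ℝ → X →L[𝕜] Y} {β : ℝ → Θ →L[𝕜] X} {c m T : ℝ}

theorem IsObservedFamily.nonneg (hD : IsObservedFamily D c) : 0 ≤ c :=
  (norm_nonneg _).trans (hD.norm_le 0)

theorem IsStrongFamily.nonneg (hβ : IsStrongFamily β m) : 0 ≤ m :=
  (norm_nonneg _).trans (hβ.norm_le 0)

theorem IsObservedFamily.apply_le (hD : IsObservedFamily D c) (t : ℝ) (x : X) :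
    ‖D t x‖ ≤ c * ‖x‖ :=
  ((D t).le_opNorm x).trans (by gcongr; exact hD.norm_le t)

theorem IsObservedFamily.adjoint_apply_le (hD : IsObservedFamily D c) (t : ℝ) (y : Y) :
    ‖(D t).adjoint y‖ ≤ c * ‖y‖ := by
  refine ((D t).adjoint.le_opNorm y).trans ?_
  rw [LinearIsometryEquiv.norm_map]
  gcongr
  exact hD.norm_le t

theorem IsStrongFamily.apply_le (hβ : IsStrongFamily β m) (t : ℝ) (x : Θ) :
    ‖β t x‖ ≤ m * ‖x‖ :=
  ((β t).le_opNorm x).trans (by gcongr; exact hβ.norm_le t)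

theorem IsObservedFamily.continuous_apply (hD : IsObservedFamily D c) {u : ℝ → X}
    (hu : Continuous u) : Continuous fun t => D t (u t) :=
  (continuous_uncurry_of_strong hD.cont hD.norm_le).comp (continuous_id.prodMk hu)

theorem IsObservedFamily.continuousOn_apply (hD : IsObservedFamily D c) {u : ℝ → X} {s : Set ℝ}
    (hu : ContinuousOn u s) : ContinuousOn (fun t => D t (u t)) s :=
  hu.strong_apply hD.cont hD.norm_le

theorem IsObservedFamily.continuous_response (hD : IsObservedFamily D c)
    (hβ : IsStrongFamily β m) (d : X) (φ : Θ) : Continuous fun t => D t (d + β t φ) :=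
  hD.continuous_apply (continuous_const.add (hβ.cont φ))

/-- The observability inequality together with coercivity of `U₀` makes the least-squares form
coercive. -/
theorem exists_coercive (hT : 0 ≤ T) (hD : IsObservedFamily D c) (hβ : IsStrongFamily β m)
    {γ : ℝ} (hγ : 0 < γ)
    (hobs : ∀ x : X, γ ^ 2 * ‖x‖ ^ 2 ≤ ∫ t in (0 : ℝ)..T, ‖D t x‖ ^ 2)
    {U₀ : Θ →L[𝕜] Θ} {δ : ℝ} (hδ : 0 < δ)
    (hU₀ : ∀ ξ : Θ, δ * ‖ξ‖ ^ 2 ≤ RCLike.re (inner 𝕜 ξ (U₀ ξ))) :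
    ∃ α : ℝ, 0 < α ∧ ∀ (d : X) (φ : Θ), α * (‖d‖ ^ 2 + ‖φ‖ ^ 2) ≤
      (∫ t in (0 : ℝ)..T, ‖D t (d + β t φ)‖ ^ 2) + RCLike.re (inner 𝕜 φ (U₀ φ)) := by
  have hc := hD.nonneg
  have hm := hβ.nonneg
  set k : ℝ := T * (c * m) ^ 2 with hk
  have hk0 : 0 ≤ k := by positivity
  -- Here k‖φ‖² bounds ∫‖Dβφ‖². The weight l ≤ 1 scales the observability inequality so that its
  -- source contribution l k‖φ‖² uses at most half of δ‖φ‖².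
  set l : ℝ := δ / (2 * (k + δ)) with hl
  have hl0 : 0 < l := by positivity
  have hl1 : l ≤ 1 := by rw [hl, div_le_one (by positivity)]; linarith
  have hlk : l * k ≤ δ / 2 := by
    rw [hl, div_mul_eq_mul_div, div_le_div_iff₀ (by positivity) two_pos]; nlinarith
  refine ⟨min (l * γ ^ 2 / 2) (δ / 2), by positivity, fun d φ => ?_⟩
  set I := ∫ t in (0 : ℝ)..T, ‖D t (d + β t φ)‖ ^ 2 with hI
  have hI0 : 0 ≤ I := intervalIntegral.integral_nonneg hT fun _ _ => by positivity
  have hcw := hD.continuous_response hβ d φ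
  -- Write D d = D(d + βφ) - Dβφ and use (a + b)² ≤ 2a² + 2b².
  have key : γ ^ 2 * ‖d‖ ^ 2 ≤ 2 * I + 2 * (k * ‖φ‖ ^ 2) := by
    have h1 : ∫ t in (0 : ℝ)..T, ‖D t d‖ ^ 2 ≤
        ∫ t in (0 : ℝ)..T, (2 * ‖D t (d + β t φ)‖ ^ 2 + 2 * ((c * m) ^ 2 * ‖φ‖ ^ 2)) := by
      refine intervalIntegral.integral_mono_on hT
        (((hD.cont d).norm.pow 2).intervalIntegrable _ _)
        ((((hcw.norm.pow 2).const_mul 2).add continuous_const).intervalIntegrable _ _)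
        fun t _ => ?_
      have e : D t d = D t (d + β t φ) - D t (β t φ) := by rw [map_add, add_sub_cancel_right]
      have h2 : ‖D t d‖ ≤ ‖D t (d + β t φ)‖ + c * m * ‖φ‖ := by
        rw [e]
        refine (norm_sub_le _ _).trans ?_
        have : ‖D t (β t φ)‖ ≤ c * (m * ‖φ‖) :=
          (hD.apply_le _ _).trans (by gcongr; exact hβ.apply_le _ _)
        linarith
      have h3 : ‖D t d‖ ^ 2 ≤ (‖D t (d + β t φ)‖ + c * m * ‖φ‖) ^ 2 := by gcongr
      nlinarith [sq_nonneg (‖D t (d + β t φ)‖ - c * m * ‖φ‖)]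
    have hi : IntervalIntegrable (fun t => 2 * ‖D t (d + β t φ)‖ ^ 2) volume 0 T :=
      ((hcw.norm.pow 2).const_mul 2).intervalIntegrable _ _
    rw [intervalIntegral.integral_add hi (continuous_const.intervalIntegrable _ _),
      intervalIntegral.integral_const_mul,
      intervalIntegral.integral_const, smul_eq_mul, sub_zero] at h1
    have := (hobs d).trans h1
    rw [hk]; linarith
  have h1 : min (l * γ ^ 2 / 2) (δ / 2) * ‖d‖ ^ 2 ≤ l * γ ^ 2 / 2 * ‖d‖ ^ 2 := by
    gcongr; exact min_le_left _ _
  have h2 : min (l * γ ^ 2 / 2) (δ / 2) * ‖φ‖ ^ 2 ≤ δ / 2 * ‖φ‖ ^ 2 := by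
    gcongr; exact min_le_right _ _
  have h3 := mul_le_mul_of_nonneg_left key hl0.le
  have h4 : l * I ≤ I := mul_le_of_le_one_left hI0 hl1
  have h5 := mul_le_mul_of_nonneg_right hlk (sq_nonneg ‖φ‖)
  have h6 := hU₀ φ
  nlinarith

/-- Normal equations of the least-squares problem with state response `D`, source response
`D β`, data `y`, prior `θ₀` and regularization `U₀`. -/
def NormalEquations (D : ℝ → X →L[𝕜] Y) (β : ℝ → Θ →L[𝕜] X) (T : ℝ) (U₀ : Θ →L[𝕜] Θ) (θ₀ : Θ)
    (y : ℝ → Y) (ζ : X) (θ : Θ) : Prop :=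
  (∀ d : X, ∫ s in (0 : ℝ)..T, inner 𝕜 (D s d) (y s - D s (ζ + β s θ)) = 0) ∧
    ∀ η : Θ, inner 𝕜 η (U₀ (θ - θ₀)) =
      ∫ s in (0 : ℝ)..T, inner 𝕜 (D s (β s η)) (y s - D s (ζ + β s θ))

/-- On the Hilbert sum of X and Θ both equations become a single one, Q q = n + (0, U₀θ₀), whose
form is coercive, so Q is invertible. Testing with (d, 0) and (0, η) recovers the two equations. -/
theorem exists_normalEquations (hT : 0 ≤ T) (hD : IsObservedFamily D c)
    (hβ : IsStrongFamily β m) {U₀ : Θ →L[𝕜] Θ} {θ₀ : Θ} {y : ℝ → Y}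
    (hy : IntegrableOn y (Set.Icc 0 T)) {α : ℝ} (hα : 0 < α)
    (hcoer : ∀ (d : X) (φ : Θ), α * (‖d‖ ^ 2 + ‖φ‖ ^ 2) ≤
      (∫ t in (0 : ℝ)..T, ‖D t (d + β t φ)‖ ^ 2) + RCLike.re (inner 𝕜 φ (U₀ φ))) :
    ∃ ζ θ, NormalEquations D β T U₀ θ₀ y ζ θ := by
  have hc := hD.nonneg
  have hm := hβ.nonneg
  have hTm : T ∈ Set.Icc 0 T := ⟨hT, le_rfl⟩
  have h0m : (0 : ℝ) ∈ Set.Icc 0 T := ⟨le_rfl, hT⟩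
  let fs := WithLp.fstL 2 𝕜 X Θ
  let sn := WithLp.sndL 2 𝕜 X Θ
  let Φ : ℝ → WithLp 2 (X × Θ) →L[𝕜] Y := fun s => (D s).comp (fs + (β s).comp sn)
  have hΦ' : ∀ s q, Φ s q = D s (q.fst + β s q.snd) := fun s q => rfl
  have hΦ : ∀ q, ContinuousOn (fun s => Φ s q) (Set.Icc 0 T) := fun q =>
    (hD.continuous_response hβ _ _).continuousOn
  have hsq := WithLp.prod_norm_sq_eq_of_L2 (α := X) (β := Θ)
  have hΦM : ∀ s ∈ Set.Icc 0 T, ∀ q, ‖Φ s q‖ ≤ c * (1 + m) * ‖q‖ := by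
    intro s _ q
    have h1 : ‖q.fst‖ ≤ ‖q‖ := by
      refine le_of_sq_le_sq ?_ (norm_nonneg _)
      rw [hsq q]; nlinarith [sq_nonneg ‖q.snd‖]
    have h2 : ‖q.snd‖ ≤ ‖q‖ := by
      refine le_of_sq_le_sq ?_ (norm_nonneg _)
      rw [hsq q]; nlinarith [sq_nonneg ‖q.fst‖]
    rw [hΦ']
    calc _ ≤ c * ‖q.fst + β s q.snd‖ := hD.apply_le _ _
      _ ≤ c * (‖q‖ + m * ‖q‖) := by
        gcongr
        refine (norm_add_le _ _).trans (add_le_add h1 ((hβ.apply_le _ _).trans ?_))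
        gcongr
      _ = _ := by ring
  obtain ⟨N, hN⟩ := exists_gramian hT (by positivity) hΦ hΦM hTm
  obtain ⟨n, hn⟩ := exists_inner_eq_integral hΦ hΦM hy hTm
  let Q : WithLp 2 (X × Θ) →L[𝕜] WithLp 2 (X × Θ) := N + sn.adjoint.comp (U₀.comp sn)
  have hQ : ∀ q q', inner 𝕜 q (Q q') =
      (∫ s in (0 : ℝ)..T, inner 𝕜 (Φ s q) (Φ s q')) + inner 𝕜 q.snd (U₀ q'.snd) := by
    intro q q'
    change inner 𝕜 q (N q' + sn.adjoint (U₀ (sn q'))) = _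
    rw [inner_add_right, hN, ContinuousLinearMap.adjoint_inner_right]
    rfl
  have hre : ∀ q, RCLike.re (inner 𝕜 q (Q q)) =
      (∫ t in (0 : ℝ)..T, ‖D t (q.fst + β t q.snd)‖ ^ 2) +
        RCLike.re (inner 𝕜 q.snd (U₀ q.snd)) := by
    intro q
    rw [hQ, map_add]
    congr 1
    simp only [inner_self_eq_norm_sq_to_K, hΦ']
    have : ∀ s, (‖D s (q.fst + β s q.snd)‖ : 𝕜) ^ 2 =
      ((‖D s (q.fst + β s q.snd)‖ ^ 2 : ℝ) : 𝕜) := fun s => by push_cast; rfl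
    simp only [this]
    rw [intervalIntegral.integral_of_le hT, intervalIntegral.integral_of_le hT, integral_ofReal,
      RCLike.ofReal_re]
  have hunit : IsUnit Q := by
    refine Q.isUnit_of_forall_le_norm_inner_map (c := ⟨α, hα.le⟩) hα fun q => ?_
    have h1 := hcoer q.fst q.snd
    rw [← hre, ← hsq q] at h1
    rw [norm_inner_symm, mul_comm]
    exact h1.trans (RCLike.re_le_norm _)
  obtain ⟨R, hR, -⟩ := isUnit_iff_exists.1 hunit
  set q := R (n + sn.adjoint (U₀ θ₀)) with hq
  have hQq : Q q = n + sn.adjoint (U₀ θ₀) := DFunLike.congr_fun hR _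
  have hmain : ∀ q' : WithLp 2 (X × Θ), inner 𝕜 q'.snd (U₀ (q.snd - θ₀)) =
      ∫ s in (0 : ℝ)..T, inner 𝕜 (D s (q'.fst + β s q'.snd))
        (y s - D s (q.fst + β s q.snd)) := by
    intro q'
    have h1 := hQ q' q
    rw [hQq, inner_add_right, hn, ContinuousLinearMap.adjoint_inner_right] at h1
    have h1' : (∫ s in (0 : ℝ)..T, inner 𝕜 (Φ s q') (y s)) + inner 𝕜 q'.snd (U₀ θ₀) =
      (∫ s in (0 : ℝ)..T, inner 𝕜 (Φ s q') (Φ s q)) + inner 𝕜 q'.snd (U₀ q.snd) := h1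
    simp only [inner_sub_right, map_sub]
    rw [intervalIntegral.integral_sub
      (intervalIntegrable_inner_of_continuousOn (hΦ q') hy h0m hTm)
      (intervalIntegrable_inner_of_continuousOn (hΦ q') (hΦ q).integrableOn_Icc h0m hTm)]
    simp only [hΦ'] at h1' ⊢
    linear_combination -h1'
  refine ⟨q.fst, q.snd, fun d => ?_, fun η => ?_⟩
  · simpa using (hmain (WithLp.toLp 2 (d, 0))).symm
  · simpa using hmain (WithLp.toLp 2 (0, η))

/-- The least-squares cost expands exactly around a solution of the normal equations. -/
theorem NormalEquations.cost_add (hT : 0 ≤ T) (hD : IsObservedFamily D c)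
    (hβ : IsStrongFamily β m) {U₀ : Θ →L[𝕜] Θ} (hU₀ : IsSelfAdjoint U₀) {θ₀ : Θ} {y : ℝ → Y}
    (hy : MemLp y 2 (volume.restrict (Set.Icc 0 T))) {ζ : X} {θ : Θ}
    (h : NormalEquations D β T U₀ θ₀ y ζ θ) (d : X) (φ : Θ) :
    RCLike.re (inner 𝕜 (θ + φ - θ₀) (U₀ (θ + φ - θ₀))) +
        ∫ t in (0 : ℝ)..T, ‖y t - D t (ζ + d + β t (θ + φ))‖ ^ 2 =
      RCLike.re (inner 𝕜 (θ - θ₀) (U₀ (θ - θ₀))) +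
        (∫ t in (0 : ℝ)..T, ‖y t - D t (ζ + β t θ)‖ ^ 2) +
        ((∫ t in (0 : ℝ)..T, ‖D t (d + β t φ)‖ ^ 2) + RCLike.re (inner 𝕜 φ (U₀ φ))) := by
  have hTm : T ∈ Set.Icc 0 T := ⟨hT, le_rfl⟩
  have h0m : (0 : ℝ) ∈ Set.Icc 0 T := ⟨le_rfl, hT⟩
  set e : ℝ → Y := fun t => y t - D t (ζ + β t θ) with he
  set w : ℝ → Y := fun t => D t (d + β t φ) with hw
  have hwc : Continuous w := hD.continuous_response hβ d φ
  have he2 : MemLp e 2 (volume.restrict (Set.Icc 0 T)) := by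
    refine hy.sub ?_
    have hcont := hD.continuous_response hβ ζ θ
    obtain ⟨M, hM⟩ := isCompact_Icc.exists_bound_of_continuousOn
      (hcont.continuousOn (s := Set.Icc 0 T))
    refine MemLp.of_bound hcont.aestronglyMeasurable M ?_
    filter_upwards [ae_restrict_mem measurableSet_Icc] with t ht using hM t ht
  have hei : IntegrableOn e (Set.Icc 0 T) := he2.integrable (by norm_num)
  have hin : IntervalIntegrable (fun t => inner 𝕜 (w t) (e t)) volume 0 T :=
    intervalIntegrable_inner_of_continuousOn hwc.continuousOn hei h0m hTm
  have hre : IntervalIntegrable (fun t => RCLike.re (inner 𝕜 (w t) (e t))) volume 0 T :=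
    ⟨hin.1.re, hin.2.re⟩
  have hsq : IntervalIntegrable (fun t => ‖e t‖ ^ 2) volume 0 T :=
    intervalIntegrable_of_mem_Icc he2.norm.integrable_sq h0m hTm
  have hw2 : IntervalIntegrable (fun t => ‖w t‖ ^ 2) volume 0 T :=
    (hwc.norm.pow 2).intervalIntegrable _ _
  have hpt : ∀ t, ‖y t - D t (ζ + d + β t (θ + φ))‖ ^ 2 =
      ‖e t‖ ^ 2 - 2 * RCLike.re (inner 𝕜 (w t) (e t)) + ‖w t‖ ^ 2 := by
    intro t
    have : y t - D t (ζ + d + β t (θ + φ)) = e t - w t := by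
      simp only [he, hw, map_add]; abel
    rw [this, norm_sub_sq (𝕜 := 𝕜), inner_re_symm]
  -- The normal equations identify the first-order term of the misfit with that of the
  -- regularization; the two cancel in the expansion.
  have hcross : ∫ t in (0 : ℝ)..T, RCLike.re (inner 𝕜 (w t) (e t)) =
      RCLike.re (inner 𝕜 φ (U₀ (θ - θ₀))) := by
    rw [h.2 φ]
    have e1 : ∫ t in (0 : ℝ)..T, inner 𝕜 (w t) (e t) =
        (∫ t in (0 : ℝ)..T, inner 𝕜 (D t d) (e t)) +
          ∫ t in (0 : ℝ)..T, inner 𝕜 (D t (β t φ)) (e t) := by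
      simp only [hw, map_add, inner_add_left]
      exact intervalIntegral.integral_add
        (intervalIntegrable_inner_of_continuousOn (hD.cont d).continuousOn hei h0m hTm)
        (intervalIntegrable_inner_of_continuousOn
          (hD.continuous_apply (hβ.cont φ)).continuousOn hei h0m hTm)
    rw [h.1 d, zero_add] at e1
    rw [← e1, intervalIntegral.integral_of_le hT, intervalIntegral.integral_of_le hT]
    exact integral_re hin.1
  simp only [hpt]
  rw [intervalIntegral.integral_add (hsq.sub (hre.const_mul 2)) hw2,
    intervalIntegral.integral_sub hsq (hre.const_mul 2), intervalIntegral.integral_const_mul,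
    hcross]
  have e2 : θ + φ - θ₀ = (θ - θ₀) + φ := by abel
  have e3 : RCLike.re (inner 𝕜 (θ - θ₀) (U₀ φ)) = RCLike.re (inner 𝕜 φ (U₀ (θ - θ₀))) := by
    rw [inner_re_symm]
    congr 1
    have := hU₀.isSymmetric φ (θ - θ₀)
    exact this
  rw [e2, map_add, inner_add_left, inner_add_right, inner_add_right, map_add, map_add, map_add,
    e3]
  ring

end LeastSquares

/-! ### Existence of the iterates -/

section Existence

variable {𝕜 X Θ Y : Type*} [RCLike 𝕜]
  [NormedAddCommGroup X] [InnerProductSpace 𝕜 X] [CompleteSpace X]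
  [NormedSpace ℝ X] [IsScalarTower ℝ 𝕜 X]
  [NormedAddCommGroup Θ] [InnerProductSpace 𝕜 Θ] [CompleteSpace Θ]
  [NormedAddCommGroup Y] [InnerProductSpace 𝕜 Y] [CompleteSpace Y]

theorem integrableOn_apply_vector {B : ℝ → Θ →L[𝕜] X} {s : Set ℝ} (hB : IntegrableOn B s)
    (η : Θ) : IntegrableOn (fun t => B t η) s := by
  refine (hB.norm.mul_const ‖η‖).mono'
    ((ContinuousLinearMap.apply 𝕜 X η).continuous.comp_aestronglyMeasurable hB.1)
    (ae_of_all _ fun t => (B t).le_opNorm η)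

/-- The source response `η ↦ ∫₀ᵗ e^{-sA} B(s) η ds`, as a bounded operator into paths. -/
theorem C0Group.exists_sourcePath (S : C0Group 𝕜 X) (hS : ∀ t x, ‖S.op t x‖ = ‖x‖) {T : ℝ}
    (hT : 0 ≤ T) {B : ℝ → Θ →L[𝕜] X} (hB : IntegrableOn B (Set.Icc 0 T)) :
    ∃ P : Θ →L[𝕜] C(Set.Icc (0 : ℝ) T, X),
      ∀ η t, P η t = ∫ s in (0 : ℝ)..t, S.op (-s) (B s η) := by
  have : SMulCommClass ℝ 𝕜 X := inferInstance
  have hTm : T ∈ Set.Icc 0 T := ⟨hT, le_rfl⟩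
  have h0m : (0 : ℝ) ∈ Set.Icc 0 T := ⟨le_rfl, hT⟩
  have hi := fun η => S.integrableOn_op_neg hS (integrableOn_apply_vector hB η)
  refine ⟨LinearMap.mkContinuous
    ⟨⟨fun η => primitivePath T _ (hi η), fun η η' => ?_⟩, fun a η => ?_⟩
    (∫ s in (0 : ℝ)..T, ‖B s‖) fun η => ?_, fun η t => rfl⟩
  · ext t
    simp only [primitivePath_apply, ContinuousMap.add_apply, map_add]
    exact intervalIntegral.integral_add (intervalIntegrable_of_mem_Icc (hi η) h0m t.2)
      (intervalIntegrable_of_mem_Icc (hi η') h0m t.2)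
  · ext t
    simp only [primitivePath_apply, ContinuousMap.smul_apply, map_smul, RingHom.id_apply]
    exact intervalIntegral.integral_smul _ _
  · have hnn : 0 ≤ ∫ s in (0 : ℝ)..T, ‖B s‖ :=
      intervalIntegral.integral_nonneg hT fun _ _ => norm_nonneg _
    refine (ContinuousMap.norm_le _ (by positivity)).2 fun t => ?_
    change ‖∫ s in (0 : ℝ)..t, S.op (-s) (B s η)‖ ≤ _
    rw [← intervalIntegral.integral_mul_const]
    have hBn : IntegrableOn (fun s => ‖B s‖ * ‖η‖) (Set.Icc 0 T) := hB.norm.mul_const _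
    refine (intervalIntegral.norm_integral_le_of_norm_le t.2.1 (ae_of_all _ fun s _ => ?_)
      (intervalIntegrable_of_mem_Icc hBn h0m t.2)).trans ?_
    · rw [hS]; exact (B s).le_opNorm η
    · exact intervalIntegral.integral_mono_interval le_rfl t.2.1 t.2.2
        (ae_of_all _ fun s => by positivity) (intervalIntegrable_of_mem_Icc hBn h0m hTm)

theorem C0Group.exists_isMildSolution (S : C0Group 𝕜 X) (hS : ∀ t x, ‖S.op t x‖ = ‖x‖) {T : ℝ}
    (hT : 0 ≤ T) (L : X →L[𝕜] X) {F : ℝ → X} (hF : IntegrableOn F (Set.Icc 0 T)) (x₀ : X) :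
    ∃ z, IsMildSolution S.op T (fun t => L (z t) + F t) x₀ z := by
  have : SMulCommClass ℝ 𝕜 X := inferInstance
  obtain ⟨R, hR⟩ := S.exists_perturbed_mild hS hT L
  exact ⟨_, hR F x₀ (.const _ x₀ + primitivePath T _ (S.integrableOn_op_neg hS hF)) hF
    (fun t => rfl) _ fun t => rfl⟩

theorem integrableOn_reflect {E : Type*} [NormedAddCommGroup E] {T : ℝ} (hT : 0 ≤ T) {f : ℝ → E}
    (hf : IntegrableOn f (Set.Icc 0 T)) : IntegrableOn (fun t => f (T - t)) (Set.Icc 0 T) := by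
  rw [← intervalIntegrable_iff_integrableOn_Icc_of_le hT] at hf ⊢
  simpa using (hf.comp_sub_left T).symm

namespace SourceProblem

/-- The observer equations with an arbitrary gain and source have mild solutions. -/
theorem exists_observer (S : C0Group 𝕜 X) (hS : ∀ t x, ‖S.op t x‖ = ‖x‖) {T : ℝ}
    (hT : 0 ≤ T) (C : X →L[𝕜] Y) (k : 𝕜) {y : ℝ → Y} (hy : IntegrableOn y (Set.Icc 0 T))
    {b : ℝ → X} (hb : IntegrableOn b (Set.Icc 0 T)) (x₀ : X) :
    ∃ z, IsMildSolution S.op T (fun t => k • C.adjoint (y t - C (z t)) + b t) x₀ z := by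
  have hF : IntegrableOn (fun t => k • C.adjoint (y t) + b t) (Set.Icc 0 T) :=
    ((C.adjoint.integrable_comp hy).smul k).add hb
  obtain ⟨z, hz⟩ := S.exists_isMildSolution hS hT (-(k • C.adjoint.comp C)) hF x₀
  refine ⟨z, ?_⟩
  convert hz using 2 with t
  simp only [neg_apply, smul_apply,
    ContinuousLinearMap.comp_apply, map_sub, smul_sub]
  abel

/-- The sensitivity operators exist, with a uniform bound. -/
theorem exists_sensitivity (S : C0Group 𝕜 X) (hS : ∀ t x, ‖S.op t x‖ = ‖x‖) {T : ℝ}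
    (hT : 0 ≤ T) (C : X →L[𝕜] Y) (k : 𝕜) {B : ℝ → Θ →L[𝕜] X}
    (hB : IntegrableOn B (Set.Icc 0 T)) :
    ∃ (P : ℝ → Θ →L[𝕜] X) (M : ℝ), 0 ≤ M ∧ (∀ t η, ‖P t η‖ ≤ M * ‖η‖) ∧
      ∀ η, IsMildSolution S.op T (fun t => -(k • C.adjoint (C (P t η))) + B t η) 0
        (fun t => P t η) := by
  have : SMulCommClass ℝ 𝕜 X := inferInstance
  obtain ⟨R, hR⟩ := S.exists_perturbed_mild hS hT (-(k • C.adjoint.comp C))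
  obtain ⟨P₀, hP₀⟩ := S.exists_sourcePath hS hT hB
  -- Π(t) is the source path, then the resolvent, then evaluation at t clamped to [0, T], then the
  -- isometry e^{tA}; hence one bound serves all t.
  refine ⟨fun t => (S.op t).comp ((ContinuousMap.evalCLM 𝕜 (Set.projIcc 0 T hT t)).comp
    (R.comp P₀)), ‖R.comp P₀‖, (R.comp P₀).opNorm_nonneg, fun t η => ?_, fun η => ?_⟩
  · change ‖S.op t (R (P₀ η) (Set.projIcc 0 T hT t))‖ ≤ _
    rw [hS]
    exact ((R (P₀ η)).norm_coe_le_norm _).trans ((R.comp P₀).le_opNorm η)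
  · exact hR (fun t => B t η) 0 (P₀ η) (integrableOn_apply_vector hB η)
      (fun t => by rw [hP₀, zero_add]) _ fun t => rfl

/-- One iteration of the method can be carried out from any state. -/
theorem exists_iteration (p : SourceProblem 𝕜 X Θ Y) (hS : ∀ t x, ‖p.S.op t x‖ = ‖x‖)
    (hT : 0 ≤ p.T) (hB : IntegrableOn p.B (Set.Icc 0 p.T))
    (hy : IntegrableOn p.y (Set.Icc 0 p.T)) (k : ℝ) (x : X) (θ : Θ) :
    ∃ (zP : ℝ → X) (P : ℝ → Θ →L[𝕜] X) (U : ℝ → Θ →L[𝕜] Θ) (ξ : ℝ → Θ) (θ' : Θ) (zM : ℝ → X),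
      IsMildSolution p.S.op p.T
        (fun t => (k : 𝕜) • p.C.adjoint (p.y t - p.C (zP t)) + p.B t θ) x zP ∧
      (∀ η : Θ, IsMildSolution p.S.op p.T
        (fun t => -((k : 𝕜) • p.C.adjoint (p.C (P t η))) + p.B t η) 0 (fun t => P t η)) ∧
      (∀ t ∈ Set.Icc 0 p.T, ∀ η η' : Θ, inner 𝕜 η (U t η') = inner 𝕜 η (p.U₀ η') +
        ∫ s in (0 : ℝ)..t, inner 𝕜 (p.C (P s η)) (p.C (P s η'))) ∧
      (∀ t ∈ Set.Icc 0 p.T, ∀ η : Θ, inner 𝕜 η (ξ t) =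
        ∫ s in (0 : ℝ)..t, inner 𝕜 (p.C (P s η)) (p.y s - p.C (zP s))) ∧
      θ' = θ - (U p.T).inverse (p.U₀ (θ - p.θ₀) - ξ p.T) ∧
      IsMildSolution (fun t => p.S.op (-t)) p.T
        (fun t => (k : 𝕜) • p.C.adjoint (p.y (p.T - t) - p.C (zM t)) - p.B (p.T - t) θ')
        (zP p.T + P p.T (θ' - θ)) zM := by
  obtain ⟨zP, hzP⟩ := exists_observer p.S hS hT p.C (k : 𝕜) hy
    (integrableOn_apply_vector hB θ) x
  obtain ⟨P, M, hM0, hPM, hP⟩ := exists_sensitivity p.S hS hT p.C (k : 𝕜) hB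
  have hΦ : ∀ η, ContinuousOn (fun s => (p.C.comp (P s)) η) (Set.Icc 0 p.T) := fun η =>
    p.C.continuous.comp_continuousOn (hP η).1
  have hΦM : ∀ s ∈ Set.Icc 0 p.T, ∀ η, ‖(p.C.comp (P s)) η‖ ≤ ‖p.C‖ * M * ‖η‖ := by
    intro s _ η
    refine (p.C.le_opNorm _).trans ?_
    rw [mul_assoc]
    gcongr
    exact hPM s η
  have hres : IntegrableOn (fun s => p.y s - p.C (zP s)) (Set.Icc 0 p.T) :=
    hy.sub (p.C.continuous.comp_continuousOn hzP.1).integrableOn_Icc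
  have hU : ∀ t, ∃ Ut : Θ →L[𝕜] Θ, t ∈ Set.Icc 0 p.T → ∀ η η' : Θ,
      inner 𝕜 η (Ut η') = inner 𝕜 η (p.U₀ η') +
        ∫ s in (0 : ℝ)..t, inner 𝕜 (p.C (P s η)) (p.C (P s η')) := by
    intro t
    by_cases ht : t ∈ Set.Icc 0 p.T
    · obtain ⟨N, hN⟩ := exists_gramian hT (by positivity) hΦ hΦM ht
      refine ⟨p.U₀ + N, fun _ η η' => ?_⟩
      rw [add_apply, inner_add_right, hN]
      rfl
    · exact ⟨0, fun h => absurd h ht⟩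
  have hξ : ∀ t, ∃ ξt : Θ, t ∈ Set.Icc 0 p.T → ∀ η : Θ, inner 𝕜 η ξt =
        ∫ s in (0 : ℝ)..t, inner 𝕜 (p.C (P s η)) (p.y s - p.C (zP s)) := by
    intro t
    by_cases ht : t ∈ Set.Icc 0 p.T
    · obtain ⟨n, hn⟩ := exists_inner_eq_integral hΦ hΦM hres ht
      exact ⟨n, fun _ => hn⟩
    · exact ⟨0, fun h => absurd h ht⟩
  choose U hU using hU
  choose ξ hξ using hξ
  set θ' := θ - (U p.T).inverse (p.U₀ (θ - p.θ₀) - ξ p.T)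
  -- The backward observer is a forward observer for the reversed group with reflected data and
  -- source -B(T - t)θ'.
  obtain ⟨zM, hzM⟩ := exists_observer p.S.reverse (fun t x => hS (-t) x) hT p.C (k : 𝕜)
    (integrableOn_reflect hT hy)
    (integrableOn_reflect hT (integrableOn_apply_vector hB θ')).neg
    (zP p.T + P p.T (θ' - θ))
  refine ⟨zP, P, U, ξ, θ', zM, hzP, hP, hU, hξ, rfl, ?_⟩
  simp only [sub_eq_add_neg] at hzM ⊢
  exact hzM

theorem nonempty_run (p : SourceProblem 𝕜 X Θ Y) (hS : ∀ t x, ‖p.S.op t x‖ = ‖x‖)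
    (hT : 0 ≤ p.T) (hB : IntegrableOn p.B (Set.Icc 0 p.T))
    (hy : IntegrableOn p.y (Set.Icc 0 p.T)) (κ : ℕ → ℝ) (ζinit : X) (θinit : Θ) :
    Nonempty (p.Run κ ζinit θinit) := by
  choose zP P U ξ θ' zM h1 h2 h3 h4 h5 h6 using p.exists_iteration hS hT hB hy
  -- `st n` holds the initial-state estimate after n iterations together with the parameter of index
  -- n + 1, the input of iteration n + 1; hence the `j - 1` below.
  let st : ℕ → X × Θ := fun n => Nat.rec (ζinit, θinit)
    (fun j q => (zM (κ (j + 1)) q.1 q.2 p.T, θ' (κ (j + 1)) q.1 q.2)) n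
  exact ⟨{
    zPlus := fun j => zP (κ j) (st (j - 1)).1 (st (j - 1)).2
    zMinus := fun j => Nat.casesOn j (fun _ => ζinit)
      fun i => zM (κ (i + 1)) (st i).1 (st i).2
    θ := fun j => (st (j - 1)).2
    sens := fun j => P (κ j) (st (j - 1)).1 (st (j - 1)).2
    U := fun j => U (κ j) (st (j - 1)).1 (st (j - 1)).2
    ξ := fun j => ξ (κ j) (st (j - 1)).1 (st (j - 1)).2
    zMinus_init := rfl
    θ_init := rfl
    forward := by
      rintro (_ | _ | j) hj
      · omega
      · exact h1 _ _ _
      · exact h1 _ _ _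
    sensitivity := fun j _ => h2 _ _ _
    U_eq := fun j _ => h3 _ _ _
    ξ_eq := fun j _ => h4 _ _ _
    θ_step := by
      rintro (_ | j) hj
      · omega
      · exact h5 _ _ _
    backward := by
      rintro (_ | j) hj
      · omega
      · exact h6 _ _ _ }⟩

end SourceProblem

end Existence

/-! ### A stochastic-approximation type lemma for real sequences -/

/-- A nonnegative sequence that contracts at rates `r κ_j` up to errors `K κ_j²` tends to zero when
`∑ κ_j = ∞` and `∑ κ_j² < ∞`. -/
theorem tendsto_zero_of_contraction {a κ : ℕ → ℝ} {r K : ℝ} (hr : 0 < r) (hK : 0 ≤ K)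
    (ha : ∀ n, 0 ≤ a n) (hκ : ∀ᶠ j in atTop, 0 ≤ κ j)
    (hsum : Tendsto (fun n => ∑ j ∈ Finset.range n, κ j) atTop atTop)
    (hsq : Summable fun j => κ j ^ 2)
    (h : ∀ᶠ j in atTop, a (j + 1) ≤ (1 - r * κ j) * a j + K * κ j ^ 2) :
    Tendsto a atTop (𝓝 0) := by
  -- Adding the tail of the error series pays all future errors in advance: a + s is eventually
  -- nonincreasing and has the same limit as a.
  set s : ℕ → ℝ := fun n => K * ∑' i, κ (i + n) ^ 2 with hs
  have hs0 : Tendsto s atTop (𝓝 0) := by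
    simpa using (tendsto_sum_nat_add fun j => κ j ^ 2).const_mul K
  have hstep : ∀ n, s n = s (n + 1) + K * κ n ^ 2 := by
    intro n
    have h1 := ((summable_nat_add_iff n).2 hsq).tsum_eq_zero_add
    have h2 : ∀ i, κ (i + 1 + n) = κ (i + (n + 1)) := fun i => by rw [add_right_comm, add_assoc]
    simp only [zero_add, h2] at h1
    simp only [hs]
    rw [h1]
    ring
  have hsn : ∀ n, 0 ≤ s n := fun n => mul_nonneg hK (tsum_nonneg fun i => sq_nonneg _)
  obtain ⟨J, hJ⟩ := eventually_atTop.1 (hκ.and h)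
  set A : ℕ → ℝ := fun n => a (n + J) + s (n + J) with hA
  have hdec : ∀ n, A (n + 1) ≤ A n - r * κ (n + J) * a (n + J) := by
    intro n
    have h1 := (hJ (n + J) (by omega)).2
    have h2 := hstep (n + J)
    have e : n + 1 + J = n + J + 1 := by omega
    simp only [hA, e]
    linarith
  have hanti : Antitone A := antitone_nat_of_succ_le fun n => by
    have := hdec n
    have h2 : 0 ≤ r * κ (n + J) * a (n + J) :=
      mul_nonneg (mul_nonneg hr.le (hJ (n + J) (by omega)).1) (ha _)
    linarith
  have hA0 : ∀ n, 0 ≤ A n := fun n => add_nonneg (ha _) (hsn _)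
  have hAlim := tendsto_atTop_ciInf hanti ⟨0, by rintro _ ⟨n, rfl⟩; exact hA0 n⟩
  set L := ⨅ n, A n
  have haJ : Tendsto (fun n => a (n + J)) atTop (𝓝 L) := by
    have := hAlim.sub (hs0.comp (tendsto_add_atTop_nat J))
    simpa [hA] using this
  have hL0 : 0 ≤ L := ge_of_tendsto' haJ fun n => ha _
  -- If L > 0, then a eventually exceeds L/2, so A drops by at least r(L/2)κ at each step;
  -- divergence of ∑κ would make A negative.
  have hL : L = 0 := by
    by_contra hne
    have hLpos : 0 < L := lt_of_le_of_ne hL0 (Ne.symm hne)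
    obtain ⟨N, hN⟩ := eventually_atTop.1 (haJ.eventually (lt_mem_nhds (half_lt_self hLpos)))
    have hbound : ∀ n, A (n + N) ≤ A N - r * (L / 2) * ∑ i ∈ Finset.range n, κ (i + (N + J)) := by
      intro n
      induction n with
      | zero => simp
      | succ n ih =>
        have h1 := hdec (n + N)
        have h2 := hN (n + N) (by omega)
        have h3 := (hJ (n + N + J) (by omega)).1
        have h4 : r * κ (n + N + J) * (L / 2) ≤ r * κ (n + N + J) * a (n + N + J) :=
          mul_le_mul_of_nonneg_left h2.le (mul_nonneg hr.le h3)
        rw [Finset.sum_range_succ]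
        have e1 : n + 1 + N = n + N + 1 := by omega
        have e2 : n + (N + J) = n + N + J := by omega
        rw [e1, e2]
        linarith
    have hdiv : Tendsto (fun n => ∑ i ∈ Finset.range n, κ (i + (N + J))) atTop atTop := by
      have h1 := (hsum.comp (tendsto_add_atTop_nat (N + J))).atTop_add
        (tendsto_const_nhds (x := -∑ i ∈ Finset.range (N + J), κ i))
      refine h1.congr fun n => ?_
      simp only [Function.comp]
      rw [add_comm n, Finset.sum_range_add]
      simp only [add_comm (N + J)]
      ring
    obtain ⟨n, hn⟩ := (hdiv.eventually (eventually_gt_atTop (A N / (r * (L / 2))))).exists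
    rw [div_lt_iff₀ (by positivity)] at hn
    have := hbound n
    have := hA0 (n + N)
    linarith
  rw [hL] at haJ
  exact (tendsto_add_atTop_iff_nat J).1 haJ

/-! ### Error equations of one iteration and first-order bounds in the gain -/

section Iteration

variable {𝕜 X Θ Y : Type*} [RCLike 𝕜]
  [NormedAddCommGroup X] [InnerProductSpace 𝕜 X] [CompleteSpace X] [NormedSpace ℝ X]
  [NormedAddCommGroup Θ] [InnerProductSpace 𝕜 Θ] [CompleteSpace Θ]
  [NormedAddCommGroup Y] [InnerProductSpace 𝕜 Y] [CompleteSpace Y]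
  {D : ℝ → X →L[𝕜] Y} {β : ℝ → Θ →L[𝕜] X} {c m T : ℝ}

theorem intervalIntegral_le_of_subset {g : ℝ → ℝ} (hg : IntegrableOn g (Set.Icc 0 T))
    (hg0 : ∀ s, 0 ≤ g s) {a b : ℝ} (ha : a ∈ Set.Icc 0 T) (hb : b ∈ Set.Icc 0 T) (hab : a ≤ b) :
    ∫ s in a..b, g s ≤ ∫ s in (0 : ℝ)..T, g s :=
  intervalIntegral.integral_mono_interval ha.1 hab hb.2 (ae_of_all _ hg0)
    (intervalIntegrable_of_mem_Icc hg ⟨le_rfl, ha.1.trans ha.2⟩ ⟨ha.1.trans ha.2, le_rfl⟩)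

/-- A path bounded by `a` plus half of any of its own bounds is bounded by `2 a`. -/
theorem norm_le_two_mul_of_self_improving (hT : 0 ≤ T) {u : ℝ → X} {a : ℝ}
    (hu : ContinuousOn u (Set.Icc 0 T))
    (h : ∀ M, (∀ t ∈ Set.Icc 0 T, ‖u t‖ ≤ M) → ∀ t ∈ Set.Icc 0 T, ‖u t‖ ≤ a + M / 2) :
    ∀ t ∈ Set.Icc 0 T, ‖u t‖ ≤ 2 * a := by
  obtain ⟨s, hs, hmax⟩ := isCompact_Icc.exists_isMaxOn ⟨0, le_rfl, hT⟩ hu.norm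
  have h1 := h ‖u s‖ (fun t ht => hmax ht) s hs
  intro t ht
  have h2 : ‖u t‖ ≤ ‖u s‖ := hmax ht
  linarith

/-- Bound on the feedback term `∫ D* (e - D u)`. -/
theorem IsObservedFamily.norm_integral_feedback_le (hD : IsObservedFamily D c) {e : ℝ → Y}
    (he : IntegrableOn e (Set.Icc 0 T)) {u : ℝ → X} {M : ℝ} (hM : ∀ t ∈ Set.Icc 0 T, ‖u t‖ ≤ M)
    {a b : ℝ} (ha : a ∈ Set.Icc 0 T) (hb : b ∈ Set.Icc 0 T) (hab : a ≤ b) :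
    ‖∫ s in a..b, (D s).adjoint (e s - D s (u s))‖ ≤
      c * (∫ s in (0 : ℝ)..T, ‖e s‖) + c ^ 2 * T * M := by
  have hc := hD.nonneg
  have hM0 : 0 ≤ M := (norm_nonneg _).trans (hM a ha)
  have h0m : (0 : ℝ) ∈ Set.Icc 0 T := ⟨le_rfl, ha.1.trans ha.2⟩
  have hTm : T ∈ Set.Icc 0 T := ⟨ha.1.trans ha.2, le_rfl⟩
  have hconst : IntegrableOn (fun _ : ℝ => c ^ 2 * M) (Set.Icc 0 T) :=
    continuous_const.integrableOn_Icc
  have hne : IntegrableOn (fun s => c * ‖e s‖) (Set.Icc 0 T) := he.norm.const_mul c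
  have hg : IntegrableOn (fun s => c * ‖e s‖ + c ^ 2 * M) (Set.Icc 0 T) := hne.add hconst
  calc _ ≤ ∫ s in a..b, (c * ‖e s‖ + c ^ 2 * M) := by
        refine intervalIntegral.norm_integral_le_of_norm_le hab (ae_of_all _ fun s hs => ?_)
          (intervalIntegrable_of_mem_Icc hg ha hb)
        have hs' : s ∈ Set.Icc 0 T := ⟨ha.1.trans hs.1.le, hs.2.trans hb.2⟩
        refine (hD.adjoint_apply_le _ _).trans ?_
        have h1 : ‖D s (u s)‖ ≤ c * M :=
          (hD.apply_le _ _).trans (mul_le_mul_of_nonneg_left (hM s hs') hc)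
        have h2 : ‖e s - D s (u s)‖ ≤ ‖e s‖ + c * M := (norm_sub_le _ _).trans (by linarith)
        nlinarith [mul_le_mul_of_nonneg_left h2 hc]
    _ ≤ ∫ s in (0 : ℝ)..T, (c * ‖e s‖ + c ^ 2 * M) :=
        intervalIntegral_le_of_subset hg (fun s => by positivity) ha hb hab
    _ = _ := by
        rw [intervalIntegral.integral_add (intervalIntegrable_of_mem_Icc hne h0m hTm)
          (intervalIntegrable_of_mem_Icc hconst h0m hTm), intervalIntegral.integral_const_mul,
          intervalIntegral.integral_const, smul_eq_mul]
        ring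

/-- Bound on the output correlation `∫ ⟨D u, e - D v⟩`. -/
theorem IsObservedFamily.norm_integral_inner_le (hT : 0 ≤ T) (hD : IsObservedFamily D c)
    {e : ℝ → Y} (he : IntegrableOn e (Set.Icc 0 T)) {u v : ℝ → X} {A M : ℝ}
    (hA : ∀ t ∈ Set.Icc 0 T, ‖u t‖ ≤ A) (hM : ∀ t ∈ Set.Icc 0 T, ‖v t‖ ≤ M) :
    ‖∫ s in (0 : ℝ)..T, inner 𝕜 (D s (u s)) (e s - D s (v s))‖ ≤
      A * (c * (∫ s in (0 : ℝ)..T, ‖e s‖) + c ^ 2 * T * M) := by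
  have hc := hD.nonneg
  have h0m : (0 : ℝ) ∈ Set.Icc 0 T := ⟨le_rfl, hT⟩
  have hTm : T ∈ Set.Icc 0 T := ⟨hT, le_rfl⟩
  have hA0 : 0 ≤ A := (norm_nonneg _).trans (hA 0 h0m)
  have hM0 : 0 ≤ M := (norm_nonneg _).trans (hM 0 h0m)
  have hconst : IntegrableOn (fun _ : ℝ => A * (c ^ 2 * M)) (Set.Icc 0 T) :=
    continuous_const.integrableOn_Icc
  have hne : IntegrableOn (fun s => A * c * ‖e s‖) (Set.Icc 0 T) := he.norm.const_mul _
  have hg : IntegrableOn (fun s => A * c * ‖e s‖ + A * (c ^ 2 * M)) (Set.Icc 0 T) :=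
    hne.add hconst
  calc _ ≤ ∫ s in (0 : ℝ)..T, (A * c * ‖e s‖ + A * (c ^ 2 * M)) := by
        refine intervalIntegral.norm_integral_le_of_norm_le hT (ae_of_all _ fun s hs => ?_)
          (intervalIntegrable_of_mem_Icc hg h0m hTm)
        have hs' : s ∈ Set.Icc 0 T := ⟨hs.1.le, hs.2⟩
        have h1 : ‖D s (v s)‖ ≤ c * M :=
          (hD.apply_le _ _).trans (mul_le_mul_of_nonneg_left (hM s hs') hc)
        have h2 : ‖e s - D s (v s)‖ ≤ ‖e s‖ + c * M := (norm_sub_le _ _).trans (by linarith)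
        have h3 : ‖D s (u s)‖ ≤ c * A :=
          (hD.apply_le _ _).trans (mul_le_mul_of_nonneg_left (hA s hs') hc)
        calc _ ≤ ‖D s (u s)‖ * ‖e s - D s (v s)‖ := norm_inner_le_norm _ _
          _ ≤ (c * A) * (‖e s‖ + c * M) := by gcongr
          _ = _ := by ring
    _ = _ := by
        rw [intervalIntegral.integral_add (intervalIntegrable_of_mem_Icc hne h0m hTm)
          (intervalIntegrable_of_mem_Icc hconst h0m hTm), intervalIntegral.integral_const_mul,
          intervalIntegral.integral_const, smul_eq_mul]
        ring

theorem IsObservedFamily.norm_integral_inner_response_le (hT : 0 ≤ T) (hD : IsObservedFamily D c)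
    {u v : ℝ → X} {A M : ℝ}
    (hA : ∀ t ∈ Set.Icc 0 T, ‖u t‖ ≤ A) (hM : ∀ t ∈ Set.Icc 0 T, ‖v t‖ ≤ M) :
    ‖∫ s in (0 : ℝ)..T, inner 𝕜 (D s (u s)) (D s (v s))‖ ≤ A * (c ^ 2 * T * M) := by
  have h := hD.norm_integral_inner_le hT (e := fun _ => 0) integrableOn_zero hA hM
  simpa only [zero_sub, inner_neg_right, intervalIntegral.integral_neg, norm_neg, norm_zero,
    intervalIntegral.integral_zero, mul_zero, zero_add] using h

/-- The error equations of one back-and-forth iteration in the moving frame, relative to a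
reference state and parameter with residual `e`: forward error `ε`, backward error `η`,
sensitivity `P`, initial-state errors `d` and `d'`, parameter error `φ`. -/
structure IsIterationError (D : ℝ → X →L[𝕜] Y) (β : ℝ → Θ →L[𝕜] X) (T : ℝ) (e : ℝ → Y)
    (U₀ : Θ →L[𝕜] Θ) (κ : ℝ) (d d' : X) (φ : Θ) (ε η : ℝ → X) (P : ℝ → Θ → X) : Prop where
  ε_cont : ContinuousOn ε (Set.Icc 0 T)
  ε_eq : ∀ t ∈ Set.Icc 0 T, ε t =
    d + β t φ + (κ : 𝕜) • ∫ s in (0 : ℝ)..t, (D s).adjoint (e s - D s (ε s))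
  η_cont : ContinuousOn η (Set.Icc 0 T)
  η_eq : ∀ t ∈ Set.Icc 0 T, η t =
    d + β t φ + (κ : 𝕜) • (∫ s in (0 : ℝ)..T, (D s).adjoint (e s - D s (ε s))) +
      (κ : 𝕜) • ∫ s in t..T, (D s).adjoint (e s - D s (η s))
  P_cont : ∀ ν, ContinuousOn (fun t => P t ν) (Set.Icc 0 T)
  P_eq : ∀ ν, ∀ t ∈ Set.Icc 0 T, P t ν =
    β t ν + (κ : 𝕜) • ∫ s in (0 : ℝ)..t, (D s).adjoint (0 - D s (P s ν))
  param : inner 𝕜 φ (U₀ φ) = (∫ s in (0 : ℝ)..T, inner 𝕜 (D s (P s φ)) (e s - D s (ε s))) -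
    ∫ s in (0 : ℝ)..T, inner 𝕜 (D s (β s φ)) (e s)
  out : d' = η 0

variable {e : ℝ → Y} {U₀ : Θ →L[𝕜] Θ} {κ : ℝ} {d d' : X} {φ : Θ} {ε η : ℝ → X} {P : ℝ → Θ → X}

namespace IsIterationError

theorem norm_state_le (hβ : IsStrongFamily β m) (t : ℝ) :
    ‖d + β t φ‖ ≤ ‖d‖ + m * ‖φ‖ :=
  (norm_add_le _ _).trans (by gcongr; exact hβ.apply_le t φ)

theorem norm_ofReal_smul (hκ : 0 ≤ κ) (x : X) : ‖(κ : 𝕜) • x‖ = κ * ‖x‖ := by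
  rw [norm_smul, RCLike.norm_ofReal, abs_of_nonneg hκ]

/-- The feedback reproduces at most κc²T ≤ 1/2 of any bound on ε, so the self-improving bound
replaces a Gronwall argument. -/
theorem forward_bound (h : IsIterationError D β T e U₀ κ d d' φ ε η P) (hT : 0 ≤ T)
    (hD : IsObservedFamily D c) (hβ : IsStrongFamily β m) (he : IntegrableOn e (Set.Icc 0 T))
    (hκ : 0 ≤ κ) (hκc : κ * (c ^ 2 * T) ≤ 1 / 2) :
    ∀ t ∈ Set.Icc 0 T, ‖ε t‖ ≤
      2 * (‖d‖ + m * ‖φ‖ + κ * (c * ∫ s in (0 : ℝ)..T, ‖e s‖)) := by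
  refine norm_le_two_mul_of_self_improving hT h.ε_cont fun M hM t ht => ?_
  have h0m : (0 : ℝ) ∈ Set.Icc 0 T := ⟨le_rfl, hT⟩
  have hM0 : 0 ≤ M := (norm_nonneg _).trans (hM t ht)
  rw [h.ε_eq t ht]
  refine (norm_add_le _ _).trans ?_
  rw [norm_ofReal_smul hκ]
  have h1 := mul_le_mul_of_nonneg_left
    (hD.norm_integral_feedback_le he hM h0m ht ht.1) hκ
  have h2 := norm_state_le (d := d) (φ := φ) hβ t
  nlinarith [mul_le_mul_of_nonneg_right hκc hM0]

/-- As in the forward sweep, but the free term also contains the forward feedback over [0, T],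
estimated through `forward_bound`; this raises the inner constants from 1, 1 to 2, 3. -/
theorem backward_bound (h : IsIterationError D β T e U₀ κ d d' φ ε η P) (hT : 0 ≤ T)
    (hD : IsObservedFamily D c) (hβ : IsStrongFamily β m) (he : IntegrableOn e (Set.Icc 0 T))
    (hκ : 0 ≤ κ) (hκc : κ * (c ^ 2 * T) ≤ 1 / 2) :
    ∀ t ∈ Set.Icc 0 T, ‖η t‖ ≤
      2 * (2 * (‖d‖ + m * ‖φ‖) + 3 * (κ * (c * ∫ s in (0 : ℝ)..T, ‖e s‖))) := by
  refine norm_le_two_mul_of_self_improving hT h.η_cont fun M hM t ht => ?_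
  have h0m : (0 : ℝ) ∈ Set.Icc 0 T := ⟨le_rfl, hT⟩
  have hTm : T ∈ Set.Icc 0 T := ⟨hT, le_rfl⟩
  have hM0 : 0 ≤ M := (norm_nonneg _).trans (hM t ht)
  have hε := h.forward_bound hT hD hβ he hκ hκc
  rw [h.η_eq t ht]
  refine (norm_add₃_le).trans ?_
  rw [norm_ofReal_smul hκ, norm_ofReal_smul hκ]
  have h1 := mul_le_mul_of_nonneg_left
    (hD.norm_integral_feedback_le he hM ht hTm ht.2) hκ
  have h2 := norm_state_le (d := d) (φ := φ) hβ t
  have h3 := mul_le_mul_of_nonneg_left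
    (hD.norm_integral_feedback_le he hε h0m hTm hT) hκ
  have h4 := mul_le_mul_of_nonneg_right hκc hM0
  have h5 := mul_le_mul_of_nonneg_right hκc ((norm_nonneg _).trans (hε t ht))
  linarith

/-- The closed-loop sensitivity differs from the open-loop response β by feedback only, hence by
O(κ) once P itself is bounded by 2m‖ν‖. -/
theorem sensitivity_bound (h : IsIterationError D β T e U₀ κ d d' φ ε η P) (hT : 0 ≤ T)
    (hD : IsObservedFamily D c) (hβ : IsStrongFamily β m)
    (hκ : 0 ≤ κ) (hκc : κ * (c ^ 2 * T) ≤ 1 / 2) (ν : Θ) :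
    ∀ t ∈ Set.Icc 0 T, ‖P t ν - β t ν‖ ≤ κ * (c ^ 2 * T * (2 * (m * ‖ν‖))) := by
  have h0m : (0 : ℝ) ∈ Set.Icc 0 T := ⟨le_rfl, hT⟩
  have key : ∀ M, (∀ t ∈ Set.Icc 0 T, ‖P t ν‖ ≤ M) → ∀ t ∈ Set.Icc 0 T,
      ‖P t ν - β t ν‖ ≤ κ * (c ^ 2 * T * M) := by
    intro M hM t ht
    rw [h.P_eq ν t ht, add_sub_cancel_left, norm_ofReal_smul hκ]
    have h1 := mul_le_mul_of_nonneg_left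
      (hD.norm_integral_feedback_le (e := fun _ => 0) integrableOn_zero hM h0m ht ht.1) hκ
    simpa only [norm_zero, intervalIntegral.integral_zero, mul_zero, zero_add] using h1
  refine key _ (norm_le_two_mul_of_self_improving hT (h.P_cont ν) fun M hM t ht => ?_)
  have hM0 : 0 ≤ M := (norm_nonneg _).trans (hM t ht)
  have h1 := norm_le_norm_add_norm_sub (β t ν) (P t ν)
  rw [norm_sub_rev] at h1
  have h2 := key M hM t ht
  have h3 := hβ.apply_le t ν
  nlinarith [mul_le_mul_of_nonneg_right hκc hM0]

end IsIterationError

end Iteration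

/-! ### The scalar inequalities behind the descent -/

/-- Here a, a', f stand for ‖d‖, ‖d'‖, ‖φ‖ and G for a bound on the feedback integrals. Since q + W
= O(κ), coercivity gives Z = I - W ≥ α(a² + f²) - O(κ), so the term -4κZ supplies -4ακ(a² + f²). By
`hκ₁` half of it absorbs the part of the κ² errors that grows with a and f, leaving the rate 2ακ.
For f, insert the lower bounds on q and W, divide by f, and absorb the κf term by `hκ₃`. -/
theorem descent_arithmetic {a f a' κ α δ k m G K Z I q W : ℝ} (ha : 0 ≤ a) (hf : 0 ≤ f)
    (hκ : 0 ≤ κ) (hα : 0 < α) (hδ : 0 < δ) (hk : 0 ≤ k) (hm : 0 ≤ m)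
    (hK : 0 ≤ K) (hG : G ≤ K * (1 + a + f)) (hG0 : 0 ≤ G)
    (hcoer : α * (a ^ 2 + f ^ 2) ≤ I + q) (hIZ : I = Z + W)
    (hq : |q + W| ≤ 3 * κ * k * m * G * f)
    (hq0 : δ * f ^ 2 ≤ q) (hW : -W ≤ k * m * f * a)
    (hstep : a' ^ 2 ≤ a ^ 2 + 2 * (-2 * κ * Z + 3 * κ ^ 2 * k * a * G) + (2 * κ * G) ^ 2)
    (hκ₁ : κ * (3 * K * (12 * k * m + 6 * k + 4 * K)) ≤ 2 * α)
    (hκ₂ : κ ≤ 1) (hκ₃ : 3 * κ * k * m * K ≤ δ / 2) :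
    a' ^ 2 ≤ (1 - 2 * α * κ) * a ^ 2 + 3 * K * (12 * k * m + 6 * k + 4 * K) * κ ^ 2 ∧
      f ≤ 2 / δ * (k * m + 3 * k * m * K) * (a + κ) := by
  have hq' := abs_le.1 hq
  constructor
  · have hZ : α * (a ^ 2 + f ^ 2) - 3 * κ * k * m * G * f ≤ Z := by linarith
    have h1 := mul_le_mul_of_nonneg_left hZ hκ
    set p : ℝ := 1 + a + f with hp
    have hp0 : 0 ≤ p := by positivity
    have hfp : f ≤ p := by linarith
    have hap : a ≤ p := by linarith
    have hGf : G * f ≤ K * p ^ 2 := by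
      calc G * f ≤ K * p * p := by gcongr
        _ = _ := by ring
    have hGa : G * a ≤ K * p ^ 2 := by
      calc G * a ≤ K * p * p := by gcongr
        _ = _ := by ring
    have hGG : G * G ≤ K * K * p ^ 2 := by
      calc G * G ≤ (K * p) * (K * p) := by gcongr
        _ = _ := by ring
    have hp2 : p ^ 2 ≤ 3 * (1 + a ^ 2 + f ^ 2) := by
      rw [hp]
      nlinarith [sq_nonneg (1 - a), sq_nonneg (1 - f), sq_nonneg (a - f)]
    have h2 : 12 * k * m * (G * f) + 6 * k * (G * a) + 4 * (G * G) ≤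
        3 * K * (12 * k * m + 6 * k + 4 * K) * (1 + a ^ 2 + f ^ 2) := by
      calc _ ≤ 12 * k * m * (K * p ^ 2) + 6 * k * (K * p ^ 2) + 4 * (K * K * p ^ 2) := by gcongr
        _ = K * (12 * k * m + 6 * k + 4 * K) * p ^ 2 := by ring
        _ ≤ K * (12 * k * m + 6 * k + 4 * K) * (3 * (1 + a ^ 2 + f ^ 2)) := by gcongr
        _ = _ := by ring
    set R := 3 * K * (12 * k * m + 6 * k + 4 * K)
    have h3 := mul_le_mul_of_nonneg_left h2 (sq_nonneg κ)
    have h4 := mul_le_mul_of_nonneg_left hκ₁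
      (mul_nonneg hκ (add_nonneg (sq_nonneg a) (sq_nonneg f)))
    have h5 : 0 ≤ 2 * α * κ * f ^ 2 := by positivity
    nlinarith
  · have h1 : f * (δ * f) ≤ f * (k * m * a + 3 * κ * k * m * G) := by linarith
    have h2 : δ * f ≤ k * m * a + 3 * κ * k * m * G := by
      rcases hf.eq_or_lt with h | h
      · rw [← h, mul_zero]; positivity
      · exact le_of_mul_le_mul_left h1 h
    have h3 : 3 * κ * k * m * G ≤ 3 * κ * k * m * (K * (1 + a + f)) := by gcongr
    have h4 := mul_le_mul_of_nonneg_right hκ₃ hf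
    have h5 : 3 * k * m * K * (κ * a) ≤ 3 * k * m * K * a := by
      gcongr; exact mul_le_of_le_one_left ha hκ₂
    have h6 : 0 ≤ k * m * κ := by positivity
    have h7 : δ / 2 * f ≤ (k * m + 3 * k * m * K) * (a + κ) := by nlinarith
    calc f = 2 / δ * (δ / 2 * f) := by field_simp
      _ ≤ 2 / δ * ((k * m + 3 * k * m * K) * (a + κ)) := by gcongr
      _ = _ := by ring

/-! ### The one-iteration estimate -/

section Iteration

variable {𝕜 X Θ Y : Type*} [RCLike 𝕜]
  [NormedAddCommGroup X] [InnerProductSpace 𝕜 X] [CompleteSpace X] [NormedSpace ℝ X]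
  [NormedAddCommGroup Θ] [InnerProductSpace 𝕜 Θ] [CompleteSpace Θ]
  [NormedAddCommGroup Y] [InnerProductSpace 𝕜 Y] [CompleteSpace Y]
  {D : ℝ → X →L[𝕜] Y} {β : ℝ → Θ →L[𝕜] X} {c m T : ℝ}
  {e : ℝ → Y} {U₀ : Θ →L[𝕜] Θ} {κ : ℝ} {d d' : X} {φ : Θ} {ε η : ℝ → X} {P : ℝ → Θ → X}

theorem IsObservedFamily.inner_integral_feedback (hT : 0 ≤ T) (hD : IsObservedFamily D c)
    (he : IntegrableOn e (Set.Icc 0 T)) {u : ℝ → X} (hu : ContinuousOn u (Set.Icc 0 T)) (x : X) :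
    inner 𝕜 x (∫ s in (0 : ℝ)..T, (D s).adjoint (e s - D s (u s))) =
      ∫ s in (0 : ℝ)..T, inner 𝕜 (D s x) (e s - D s (u s)) := by
  have hres : IntegrableOn (fun s => e s - D s (u s)) (Set.Icc 0 T) :=
    he.sub (hD.continuousOn_apply hu).integrableOn_Icc
  have hi : IntervalIntegrable (fun s => (D s).adjoint (e s - D s (u s))) volume 0 T :=
    intervalIntegrable_of_mem_Icc (integrable_strong_apply hD.cont_adjoint
      (fun t => (LinearIsometryEquiv.norm_map _ _).trans_le (hD.norm_le t)) hres)
      ⟨le_rfl, hT⟩ ⟨hT, le_rfl⟩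
  have := ContinuousLinearMap.intervalIntegral_comp_comm (innerSL 𝕜 x) hi
  simp only [innerSL_apply_apply, ContinuousLinearMap.adjoint_inner_right] at this
  exact this.symm

theorem re_integral_inner_self (hT : 0 ≤ T) (u : ℝ → Y) :
    RCLike.re (∫ s in (0 : ℝ)..T, inner 𝕜 (u s) (u s)) = ∫ s in (0 : ℝ)..T, ‖u s‖ ^ 2 := by
  have : ∀ s, inner 𝕜 (u s) (u s) = ((‖u s‖ ^ 2 : ℝ) : 𝕜) := fun s => by
    rw [inner_self_eq_norm_sq_to_K]; push_cast; rfl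
  simp only [this]
  rw [intervalIntegral.integral_of_le hT, intervalIntegral.integral_of_le hT, integral_ofReal,
    RCLike.ofReal_re]

set_option maxHeartbeats 1000000 in
/-- One back-and-forth iteration with a small gain contracts the initial-state error, and the
parameter error is controlled by the initial-state error. -/
theorem exists_iteration_estimate (hT : 0 ≤ T) (hD : IsObservedFamily D c)
    (hβ : IsStrongFamily β m) (hβ0 : β 0 = 0) (he : IntegrableOn e (Set.Icc 0 T))
    (horth : ∀ x : X, ∫ s in (0 : ℝ)..T, inner 𝕜 (D s x) (e s) = 0)
    {α : ℝ} (hα : 0 < α)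
    (hcoer : ∀ (d : X) (φ : Θ), α * (‖d‖ ^ 2 + ‖φ‖ ^ 2) ≤
      (∫ t in (0 : ℝ)..T, ‖D t (d + β t φ)‖ ^ 2) + RCLike.re (inner 𝕜 φ (U₀ φ)))
    {δ : ℝ} (hδ : 0 < δ)
    (hU₀ : ∀ ξ : Θ, δ * ‖ξ‖ ^ 2 ≤ RCLike.re (inner 𝕜 ξ (U₀ ξ))) :
    ∃ κ₀ r K : ℝ, 0 < κ₀ ∧ 0 < r ∧ 0 ≤ K ∧ ∀ κ : ℝ, 0 ≤ κ → κ ≤ κ₀ →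
      ∀ (d d' : X) (φ : Θ) (ε η : ℝ → X) (P : ℝ → Θ → X),
        IsIterationError D β T e U₀ κ d d' φ ε η P →
          ‖d'‖ ^ 2 ≤ (1 - r * κ) * ‖d‖ ^ 2 + K * κ ^ 2 ∧ ‖φ‖ ≤ K * (‖d‖ + κ) := by
  have hc := hD.nonneg
  have hm := hβ.nonneg
  have h0m : (0 : ℝ) ∈ Set.Icc 0 T := ⟨le_rfl, hT⟩
  have hTm : T ∈ Set.Icc 0 T := ⟨hT, le_rfl⟩
  set E : ℝ := ∫ s in (0 : ℝ)..T, ‖e s‖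
  have hE : 0 ≤ E := intervalIntegral.integral_nonneg hT fun _ _ => norm_nonneg _
  set k : ℝ := c ^ 2 * T with hk
  have hk0 : 0 ≤ k := by positivity
  -- K₀ is chosen so that G ≤ K₀(1 + ‖d‖ + ‖φ‖) for the G below; K₁ and K₂ are the resulting
  -- constants of `descent_arithmetic`.
  set K₀ : ℝ := c * E * (1 + 6 * k) + 4 * k + 4 * k * m with hK₀
  have hK₀0 : 0 ≤ K₀ := by positivity
  set K₁ : ℝ := 3 * K₀ * (12 * k * m + 6 * k + 4 * K₀) with hK₁
  have hK₁0 : 0 ≤ K₁ := by positivity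
  set K₂ : ℝ := 2 / δ * (k * m + 3 * k * m * K₀) with hK₂
  have hK₂0 : 0 ≤ K₂ := by positivity
  -- All smallness conditions hold strictly at κ = 0, hence on a ball of radius ρ; κ₀ = ρ/2 stays
  -- inside it.
  have hev : ∀ᶠ κ : ℝ in 𝓝 0, κ * K₁ < 2 * α ∧ κ < 1 ∧ 3 * κ * k * m * K₀ < δ / 2 ∧
      κ * k < 1 / 2 := by
    refine Eventually.and ?_ (Eventually.and ?_ (Eventually.and ?_ ?_))
    · refine ContinuousAt.eventually_lt (by fun_prop) continuousAt_const ?_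
      simpa using hα
    · exact gt_mem_nhds one_pos
    · refine ContinuousAt.eventually_lt (by fun_prop) continuousAt_const ?_
      simpa using hδ
    · refine ContinuousAt.eventually_lt (by fun_prop) continuousAt_const ?_
      norm_num
  obtain ⟨ρ, hρ, hball⟩ := Metric.eventually_nhds_iff.1 hev
  refine ⟨ρ / 2, 2 * α, K₁ + K₂, by positivity, by positivity, by positivity,
    fun κ hκ hκρ d d' φ ε η P h => ?_⟩
  obtain ⟨hκ₁, hκ₂, hκ₃, hκc⟩ := hball (y := κ) (by
    rw [Real.dist_eq, sub_zero, abs_of_nonneg hκ]; linarith)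
  -- M dominates both observer errors because κ ≤ 1, and G then dominates every feedback integral.
  set M : ℝ := 4 * (‖d‖ + m * ‖φ‖) + 6 * (c * E) with hM
  set G : ℝ := c * E + c ^ 2 * T * M with hG
  have hM0 : 0 ≤ M := by positivity
  have hG0 : 0 ≤ G := by positivity
  have hκcE : κ * (c * E) ≤ c * E := mul_le_of_le_one_left (by positivity) hκ₂.le
  have hdm : 0 ≤ ‖d‖ + m * ‖φ‖ := by positivity
  have hcE : 0 ≤ c * E := by positivity
  have hεM : ∀ t ∈ Set.Icc 0 T, ‖ε t‖ ≤ M := fun t ht =>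
    (h.forward_bound hT hD hβ he hκ hκc.le t ht).trans (by rw [hM]; linarith)
  have hηM : ∀ t ∈ Set.Icc 0 T, ‖η t‖ ≤ M := fun t ht =>
    (h.backward_bound hT hD hβ he hκ hκc.le t ht).trans (by rw [hM]; linarith)
  set w : ℝ → X := fun t => d + β t φ with hw
  have hwc : Continuous w := continuous_const.add (hβ.cont φ)
  have hεw : ∀ t ∈ Set.Icc 0 T, ‖ε t - w t‖ ≤ κ * G := by
    intro t ht
    rw [h.ε_eq t ht, hw, add_sub_cancel_left, IsIterationError.norm_ofReal_smul hκ]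
    exact mul_le_mul_of_nonneg_left (hD.norm_integral_feedback_le he hεM h0m ht ht.1) hκ
  have hηw : ∀ t ∈ Set.Icc 0 T, ‖η t - w t‖ ≤ 2 * κ * G := by
    intro t ht
    rw [h.η_eq t ht, hw, add_assoc, add_sub_cancel_left, ← smul_add,
      IsIterationError.norm_ofReal_smul hκ]
    have h1 := hD.norm_integral_feedback_le he hεM h0m hTm hT
    have h2 := hD.norm_integral_feedback_le he hηM ht hTm ht.2
    have := mul_le_mul_of_nonneg_left ((norm_add_le _ _).trans (add_le_add h1 h2)) hκ
    linarith
  have hPβ := h.sensitivity_bound hT hD hβ hκ hκc.le φ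
  -- integrability facts
  have hI1 : ∀ {u : ℝ → X}, ContinuousOn u (Set.Icc 0 T) →
      IntervalIntegrable (fun s => inner 𝕜 (D s (u s)) (e s)) volume 0 T := fun hu =>
    intervalIntegrable_inner_of_continuousOn (hD.continuousOn_apply hu) he h0m hTm
  have hI2 : ∀ {u v : ℝ → X}, ContinuousOn u (Set.Icc 0 T) → ContinuousOn v (Set.Icc 0 T) →
      IntervalIntegrable (fun s => inner 𝕜 (D s (u s)) (D s (v s))) volume 0 T := fun hu hv =>
    intervalIntegrable_inner_of_continuousOn (hD.continuousOn_apply hu)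
      (hD.continuousOn_apply hv).integrableOn_Icc h0m hTm
  have hβc : ContinuousOn (fun s => β s φ) (Set.Icc 0 T) := (hβ.cont φ).continuousOn
  have hdc : ContinuousOn (fun _ : ℝ => d) (Set.Icc 0 T) := continuousOn_const
  have hwc' : ContinuousOn w (Set.Icc 0 T) := hwc.continuousOn
  -- the two quadratic terms
  set Z : 𝕜 := ∫ s in (0 : ℝ)..T, inner 𝕜 (D s d) (D s (w s)) with hZ
  set W : 𝕜 := ∫ s in (0 : ℝ)..T, inner 𝕜 (D s (β s φ)) (D s (w s)) with hW
  have hZW : (∫ s in (0 : ℝ)..T, ‖D s (w s)‖ ^ 2) = RCLike.re Z + RCLike.re W := by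
    rw [← re_integral_inner_self (𝕜 := 𝕜) hT, ← map_add, hZ, hW,
      ← intervalIntegral.integral_add (hI2 hdc hwc') (hI2 hβc hwc')]
    simp only [← inner_add_left, ← map_add, hw]
  have hsplit : ∀ {u v : ℝ → X}, ContinuousOn u (Set.Icc 0 T) → ContinuousOn v (Set.Icc 0 T) →
      ∫ s in (0 : ℝ)..T, inner 𝕜 (D s (u s)) (e s - D s (v s)) =
        (∫ s in (0 : ℝ)..T, inner 𝕜 (D s (u s)) (e s)) -
          (∫ s in (0 : ℝ)..T, inner 𝕜 (D s (u s)) (D s (w s))) -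
          ∫ s in (0 : ℝ)..T, inner 𝕜 (D s (u s)) (D s (v s - w s)) := by
    intro u v hu hv
    rw [← intervalIntegral.integral_sub (hI1 hu) (hI2 hu hwc'),
      ← intervalIntegral.integral_sub ((hI1 hu).sub (hI2 hu hwc')) 
        (hI2 hu (v := fun s => v s - w s) (hv.sub hwc'))]
    refine intervalIntegral.integral_congr fun s _ => ?_
    simp only [inner_sub_right, map_sub]
    ring
  -- The residual is orthogonal to all state responses (`horth`), so only -Z and the deviation of v
  -- from w remain. With R = κG and R = 2κG this produces the 3κ² in `hinner`.
  have hcross : ∀ {v : ℝ → X} {R : ℝ}, ContinuousOn v (Set.Icc 0 T) →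
      (∀ t ∈ Set.Icc 0 T, ‖v t - w t‖ ≤ R) →
      RCLike.re (inner 𝕜 d (∫ s in (0 : ℝ)..T, (D s).adjoint (e s - D s (v s)))) ≤
        -RCLike.re Z + ‖d‖ * (k * R) := by
    intro v R hv hR
    have h1 := (RCLike.abs_re_le_norm _).trans (hD.norm_integral_inner_response_le hT
      (u := fun _ => d) (v := fun s => v s - w s) (fun _ _ => le_rfl) hR)
    rw [hD.inner_integral_feedback hT he hv, hsplit hdc hv, horth, zero_sub, map_sub, map_neg]
    have := (abs_le.1 h1).1
    linarith
  -- At time 0 the source response vanishes (`hβ0`), so the state update consists of the two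
  -- feedback integrals alone.
  have hd' : d' - d = (κ : 𝕜) • ((∫ s in (0 : ℝ)..T, (D s).adjoint (e s - D s (ε s))) +
      ∫ s in (0 : ℝ)..T, (D s).adjoint (e s - D s (η s))) := by
    rw [h.out, h.η_eq 0 h0m, hβ0, smul_add, zero_apply]
    abel
  have hinner : RCLike.re (inner 𝕜 d (d' - d)) ≤
      -2 * κ * RCLike.re Z + 3 * κ ^ 2 * k * ‖d‖ * G := by
    rw [hd', inner_smul_right, inner_add_right, RCLike.re_ofReal_mul, map_add]
    have := mul_le_mul_of_nonneg_left (add_le_add (hcross h.ε_cont hεw) (hcross h.η_cont hηw)) hκ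
    linarith
  have hnorm : ‖d' - d‖ ≤ 2 * κ * G := by
    rw [hd', IsIterationError.norm_ofReal_smul hκ]
    have h1 := hD.norm_integral_feedback_le he hεM h0m hTm hT
    have h2 := hD.norm_integral_feedback_le he hηM h0m hTm hT
    have := mul_le_mul_of_nonneg_left ((norm_add_le _ _).trans (add_le_add h1 h2)) hκ
    linarith
  have hstep : ‖d'‖ ^ 2 ≤ ‖d‖ ^ 2 + 2 * (-2 * κ * RCLike.re Z + 3 * κ ^ 2 * k * ‖d‖ * G) +
      (2 * κ * G) ^ 2 := by
    have h1 := norm_add_sq (𝕜 := 𝕜) d (d' - d)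
    rw [add_sub_cancel] at h1
    have h2 : ‖d' - d‖ ^ 2 ≤ (2 * κ * G) ^ 2 := by gcongr
    linarith
  -- The correlation of e with Dβφ cancels; both remaining integrals contain an O(κ) factor, P - β
  -- or ε - w.
  have hparam : inner 𝕜 φ (U₀ φ) + W =
      (∫ s in (0 : ℝ)..T, inner 𝕜 (D s (P s φ - β s φ)) (e s - D s (ε s))) -
        ∫ s in (0 : ℝ)..T, inner 𝕜 (D s (β s φ)) (D s (ε s - w s)) := by
    have h1 : ∫ s in (0 : ℝ)..T, inner 𝕜 (D s (P s φ - β s φ)) (e s - D s (ε s)) =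
        (∫ s in (0 : ℝ)..T, inner 𝕜 (D s (P s φ)) (e s - D s (ε s))) -
          ∫ s in (0 : ℝ)..T, inner 𝕜 (D s (β s φ)) (e s - D s (ε s)) := by
      have hres : ∀ {u : ℝ → X}, ContinuousOn u (Set.Icc 0 T) → IntervalIntegrable
          (fun s => inner 𝕜 (D s (u s)) (e s - D s (ε s))) volume 0 T := fun hu =>
        intervalIntegrable_inner_of_continuousOn (hD.continuousOn_apply hu)
          (he.sub (hD.continuousOn_apply h.ε_cont).integrableOn_Icc) h0m hTm
      rw [← intervalIntegral.integral_sub (hres (h.P_cont φ)) (hres hβc)]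
      simp only [map_sub, inner_sub_left]
    rw [h1, hsplit hβc h.ε_cont, h.param]
    ring
  have hβφ : ∀ t ∈ Set.Icc 0 T, ‖β t φ‖ ≤ m * ‖φ‖ := fun t _ => hβ.apply_le t φ
  have hq : |RCLike.re (inner 𝕜 φ (U₀ φ)) + RCLike.re W| ≤ 3 * κ * k * m * G * ‖φ‖ := by
    rw [← map_add, hparam]
    refine (RCLike.abs_re_le_norm _).trans ((norm_sub_le _ _).trans ?_)
    have h1 := hD.norm_integral_inner_le hT he hPβ hεM
    have h2 := hD.norm_integral_inner_response_le hT hβφ hεw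
    calc _ ≤ κ * (c ^ 2 * T * (2 * (m * ‖φ‖))) * G + m * ‖φ‖ * (c ^ 2 * T * (κ * G)) :=
          add_le_add h1 h2
      _ = _ := by rw [hk]; ring
  -- W contains ∫‖Dβφ‖² ≥ 0; only its cross term with d can be negative.
  have hWneg : -RCLike.re W ≤ k * m * ‖φ‖ * ‖d‖ := by
    have h1 : W = (∫ s in (0 : ℝ)..T, inner 𝕜 (D s (β s φ)) (D s d)) +
        ∫ s in (0 : ℝ)..T, inner 𝕜 (D s (β s φ)) (D s (β s φ)) := by
      rw [hW, ← intervalIntegral.integral_add (hI2 hβc hdc) (hI2 hβc hβc)]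
      simp only [← inner_add_right, ← map_add, hw]
    have h2 := (RCLike.abs_re_le_norm _).trans (hD.norm_integral_inner_response_le hT hβφ
      (v := fun _ => d) (fun _ _ => le_rfl))
    have h3 : 0 ≤ ∫ s in (0 : ℝ)..T, ‖D s (β s φ)‖ ^ 2 :=
      intervalIntegral.integral_nonneg hT fun _ _ => by positivity
    rw [h1, map_add, re_integral_inner_self hT]
    have h4 := (abs_le.1 h2).1
    have h5 : m * ‖φ‖ * (c ^ 2 * T * ‖d‖) = k * m * ‖φ‖ * ‖d‖ := by rw [hk]; ring
    linarith
  have hGK : G ≤ K₀ * (1 + ‖d‖ + ‖φ‖) := by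
    have e1 : G = c * E * (1 + 6 * k) + 4 * k * ‖d‖ + 4 * k * m * ‖φ‖ := by
      rw [hG, hM, ← hk]; ring
    have e2 : K₀ * (1 + ‖d‖ + ‖φ‖) - G = c * E * (1 + 6 * k) * (‖d‖ + ‖φ‖) +
        4 * k * (1 + ‖φ‖) + 4 * k * m * (1 + ‖d‖) := by
      rw [e1, hK₀]; ring
    rw [← sub_nonneg, e2]
    positivity
  obtain ⟨r1, r2⟩ := descent_arithmetic (norm_nonneg d) (norm_nonneg φ) hκ hα hδ hk0 hm hK₀0
    hGK hG0 (hcoer d φ) hZW hq (hU₀ φ) hWneg hstep hκ₁.le hκ₂.le hκ₃.le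
  constructor
  · refine r1.trans ?_
    have : 0 ≤ K₂ * κ ^ 2 := by positivity
    linarith
  · refine r2.trans ?_
    have : 0 ≤ K₁ * (‖d‖ + κ) := by positivity
    linarith

end Iteration

/-! ### Observers in the moving frame -/

section MovingFrame

variable {𝕜 X Y : Type*} [RCLike 𝕜]
  [NormedAddCommGroup X] [InnerProductSpace 𝕜 X] [CompleteSpace X]
  [NormedSpace ℝ X] [IsScalarTower ℝ 𝕜 X]
  [NormedAddCommGroup Y] [InnerProductSpace 𝕜 Y] [CompleteSpace Y]

/-- A mild solution with feedback and source terms, in the moving frame. -/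
theorem C0Group.moving_frame_eq (S : C0Group 𝕜 X) (hS : ∀ t x, ‖S.op t x‖ = ‖x‖) {T : ℝ}
    (hT : 0 ≤ T) (L : Y →L[𝕜] X) (k : 𝕜) {g : ℝ → Y} (hg : IntegrableOn g (Set.Icc 0 T))
    {b : ℝ → X} (hb : IntegrableOn b (Set.Icc 0 T)) {x : X} {z : ℝ → X}
    (hz : IsMildSolution S.op T (fun t => k • L (g t) + b t) x z) {t : ℝ}
    (ht : t ∈ Set.Icc 0 T) :
    S.op (-t) (z t) = x + k • (∫ s in (0 : ℝ)..t, S.op (-s) (L (g s))) +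
      ∫ s in (0 : ℝ)..t, S.op (-s) (b s) := by
  have : SMulCommClass ℝ 𝕜 X := inferInstance
  have h0m : (0 : ℝ) ∈ Set.Icc 0 T := ⟨le_rfl, hT⟩
  have hLg : IntegrableOn (fun s => L (g s)) (Set.Icc 0 T) := L.integrable_comp hg
  have h1 := intervalIntegrable_of_mem_Icc (S.integrableOn_op_neg hS hLg) h0m ht
  have h2 := intervalIntegrable_of_mem_Icc (S.integrableOn_op_neg hS hb) h0m ht
  have hF : IntegrableOn (fun t => k • L (g t) + b t) (Set.Icc 0 T) := (hLg.smul k).add hb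
  have h3 := (S.isMildSolution_iff hS hT hz.1 hF).1 hz t ht
  have h4 : ∫ s in (0 : ℝ)..t, S.op (-s) (k • L (g s) + b s) =
      k • (∫ s in (0 : ℝ)..t, S.op (-s) (L (g s))) + ∫ s in (0 : ℝ)..t, S.op (-s) (b s) := by
    simp only [map_add, map_smul]
    rw [← intervalIntegral.integral_smul]
    exact intervalIntegral.integral_add (h1.smul k) h2
  rw [h3, add_assoc]
  exact congrArg (x + ·) h4

/-- A mild solution of the time-reversed equation, in the moving frame and in forward time. -/
theorem C0Group.moving_frame_backward_eq (S : C0Group 𝕜 X) (hS : ∀ t x, ‖S.op t x‖ = ‖x‖)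
    {T : ℝ} (hT : 0 ≤ T) (L : Y →L[𝕜] X) (k : 𝕜) {g : ℝ → Y}
    (hg : IntegrableOn g (Set.Icc 0 T)) {b : ℝ → X} (hb : IntegrableOn b (Set.Icc 0 T)) {x : X}
    {z : ℝ → X}
    (hz : IsMildSolution (fun t => S.op (-t)) T (fun t => k • L (g (T - t)) - b (T - t)) x z)
    {s : ℝ} (hs : s ∈ Set.Icc 0 T) :
    S.op (-s) (z (T - s)) = S.op (-T) x + k • (∫ σ in s..T, S.op (-σ) (L (g σ))) -
      ∫ σ in s..T, S.op (-σ) (b σ) := by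
  have hs' : T - s ∈ Set.Icc 0 T := ⟨by linarith [hs.2], by linarith [hs.1]⟩
  have h0m : (0 : ℝ) ∈ Set.Icc 0 T := ⟨le_rfl, hT⟩
  have hz' : IsMildSolution S.reverse.op T
      (fun t => k • L (g (T - t)) + (fun r => -b (T - r)) t) x z := by
    simp only [sub_eq_add_neg] at hz ⊢
    exact hz
  have hgr := integrableOn_reflect hT hg
  have hbr : IntegrableOn (fun r => -b (T - r)) (Set.Icc 0 T) := (integrableOn_reflect hT hb).neg
  have h := S.reverse.moving_frame_eq (fun t x => hS (-t) x) hT L k hgr hbr hz' hs'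
  have hLg : IntegrableOn (fun s => L (g (T - s))) (Set.Icc 0 T) := L.integrable_comp hgr
  have hi1 := intervalIntegrable_of_mem_Icc
    (S.reverse.integrableOn_op_neg (fun t x => hS (-t) x) hLg) h0m hs'
  have hi2 := intervalIntegrable_of_mem_Icc
    (S.reverse.integrableOn_op_neg (fun t x => hS (-t) x) hbr) h0m hs'
  -- Backward time r is forward time T - r; applying e^{-TA} brings the reversed frame into the
  -- forward one.
  have hback : ∀ (r : ℝ) (v : X), S.op (-T) (S.reverse.op (-r) v) = S.op (-(T - r)) v := by
    intro r v
    change S.op (-T) (S.op (- -r) v) = _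
    rw [op_op]
    congr 2
    ring
  have h1 := congrArg (S.op (-T)) h
  rw [hback, map_add, map_add, map_smul, ← ContinuousLinearMap.intervalIntegral_comp_comm _ hi1,
    ← ContinuousLinearMap.intervalIntegral_comp_comm _ hi2] at h1
  simp only [hback] at h1
  have e1 : ∫ r in (0 : ℝ)..(T - s), S.op (-(T - r)) (L (g (T - r))) =
      ∫ σ in s..T, S.op (-σ) (L (g σ)) := by
    rw [intervalIntegral.integral_comp_sub_left (fun σ => S.op (-σ) (L (g σ))) T, sub_zero,
      sub_sub_cancel]
  have e2 : ∫ r in (0 : ℝ)..(T - s), S.op (-(T - r)) (-b (T - r)) =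
      -∫ σ in s..T, S.op (-σ) (b σ) := by
    rw [intervalIntegral.integral_comp_sub_left (fun σ => S.op (-σ) (-b σ)) T, sub_zero,
      sub_sub_cancel, ← intervalIntegral.integral_neg]
    simp only [map_neg]
  rw [e1, e2, sub_sub_cancel, ← sub_eq_add_neg] at h1
  exact h1

end MovingFrame

/-! ### From the method to the abstract error equations -/

namespace SourceProblem

variable {𝕜 X Θ Y : Type*} [RCLike 𝕜]
  [NormedAddCommGroup X] [InnerProductSpace 𝕜 X] [CompleteSpace X]
  [NormedSpace ℝ X] [IsScalarTower ℝ 𝕜 X]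
  [NormedAddCommGroup Θ] [InnerProductSpace 𝕜 Θ] [CompleteSpace Θ]
  [NormedAddCommGroup Y] [InnerProductSpace 𝕜 Y] [CompleteSpace Y]

/-- The state response `D(t) = C e^{tA}` of the output. -/
noncomputable def stateResponse (p : SourceProblem 𝕜 X Θ Y) (t : ℝ) : X →L[𝕜] Y :=
  p.C.comp (p.S.op t)

theorem stateResponse_apply (p : SourceProblem 𝕜 X Θ Y) (t : ℝ) (x : X) :
    p.stateResponse t x = p.C (p.S.op t x) := rfl

theorem stateResponse_op_neg (p : SourceProblem 𝕜 X Θ Y) (t : ℝ) (x : X) :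
    p.stateResponse t (p.S.op (-t) x) = p.C x := by
  rw [stateResponse_apply, C0Group.op_op_neg]

theorem adjoint_stateResponse (p : SourceProblem 𝕜 X Θ Y) (hS : ∀ t x, ‖p.S.op t x‖ = ‖x‖)
    (t : ℝ) (y : Y) : (p.stateResponse t).adjoint y = p.S.op (-t) (p.C.adjoint y) := by
  rw [stateResponse, ContinuousLinearMap.adjoint_comp, p.S.adjoint_op hS]
  rfl

theorem isObservedFamily_stateResponse (p : SourceProblem 𝕜 X Θ Y)
    (hS : ∀ t x, ‖p.S.op t x‖ = ‖x‖) : IsObservedFamily p.stateResponse ‖p.C‖ where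
  cont x := p.C.continuous.comp (p.S.continuous_orbit x)
  cont_adjoint y := by
    simp only [p.adjoint_stateResponse hS]
    exact p.S.reverse.continuous_orbit _
  norm_le t := ContinuousLinearMap.opNorm_le_bound _ (norm_nonneg _) fun x => by
    rw [stateResponse_apply, ← hS t x]
    exact p.C.le_opNorm _

/-- `β(t) = ∫₀ᵗ e^{-sA} B(s) ds` on `[0, T]`, as a strongly continuous family on the line. -/
theorem exists_sourceResponse (p : SourceProblem 𝕜 X Θ Y) (hS : ∀ t x, ‖p.S.op t x‖ = ‖x‖)
    (hT : 0 ≤ p.T) (hB : IntegrableOn p.B (Set.Icc 0 p.T)) :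
    ∃ (β : ℝ → Θ →L[𝕜] X) (m : ℝ), IsStrongFamily β m ∧
      ∀ t ∈ Set.Icc 0 p.T, ∀ η, β t η = ∫ s in (0 : ℝ)..t, p.S.op (-s) (p.B s η) := by
  obtain ⟨P, hP⟩ := p.S.exists_sourcePath hS hT hB
  refine ⟨fun t => (ContinuousMap.evalCLM 𝕜 (Set.projIcc 0 p.T hT t)).comp P, ‖P‖, ⟨?_, ?_⟩, ?_⟩
  · exact fun η => (P η).continuous.comp continuous_projIcc
  · exact fun t => ContinuousLinearMap.opNorm_le_bound _ P.opNorm_nonneg fun η =>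
      ((P η).norm_coe_le_norm _).trans (P.le_opNorm η)
  · intro t ht η
    change P η (Set.projIcc 0 p.T hT t) = _
    rw [Set.projIcc_of_mem hT ht, hP]

theorem openLoop_eq (p : SourceProblem 𝕜 X Θ Y) (hS : ∀ t x, ‖p.S.op t x‖ = ‖x‖)
    (hT : 0 ≤ p.T) (hB : IntegrableOn p.B (Set.Icc 0 p.T)) {β : ℝ → Θ →L[𝕜] X} {m : ℝ}
    (hβ : IsStrongFamily β m)
    (hβB : ∀ t ∈ Set.Icc 0 p.T, ∀ η, β t η = ∫ s in (0 : ℝ)..t, p.S.op (-s) (p.B s η))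
    (ζ : X) (ξ : Θ) {t : ℝ} (ht : t ∈ Set.Icc 0 p.T) :
    p.openLoop ζ ξ t = p.S.op t (ζ + β t ξ) := by
  have hz : Continuous fun t => p.S.op t (ζ + β t ξ) :=
    (continuous_uncurry_of_strong p.S.continuous_orbit (p.S.norm_op_le hS)).comp
      (continuous_id.prodMk (continuous_const.add (hβ.cont ξ)))
  have h := (p.S.isMildSolution_iff hS hT hz.continuousOn (x₀ := ζ)
    (integrableOn_apply_vector hB ξ)).2 fun t ht => by
      rw [C0Group.op_neg_op, hβB t ht]
  exact (h.2.2 t ht).symm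

theorem cost_eq (p : SourceProblem 𝕜 X Θ Y) (hS : ∀ t x, ‖p.S.op t x‖ = ‖x‖)
    (hT : 0 ≤ p.T) (hB : IntegrableOn p.B (Set.Icc 0 p.T)) {β : ℝ → Θ →L[𝕜] X} {m : ℝ}
    (hβ : IsStrongFamily β m)
    (hβB : ∀ t ∈ Set.Icc 0 p.T, ∀ η, β t η = ∫ s in (0 : ℝ)..t, p.S.op (-s) (p.B s η))
    (ζ : X) (ξ : Θ) :
    p.cost ζ ξ = RCLike.re (inner 𝕜 (ξ - p.θ₀) (p.U₀ (ξ - p.θ₀))) +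
      ∫ t in (0 : ℝ)..p.T, ‖p.y t - p.stateResponse t (ζ + β t ξ)‖ ^ 2 := by
  rw [cost]
  congr 1
  refine intervalIntegral.integral_congr fun t ht => ?_
  rw [Set.uIcc_of_le hT] at ht
  simp only [p.openLoop_eq hS hT hB hβ hβB ζ ξ ht, stateResponse_apply]

/-- Each iteration of a run satisfies the error equations relative to any solution of the normal
equations. -/
theorem Run.isIterationError {p : SourceProblem 𝕜 X Θ Y} (hS : ∀ t x, ‖p.S.op t x‖ = ‖x‖)
    (hT : 0 ≤ p.T) (hB : IntegrableOn p.B (Set.Icc 0 p.T))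
    (hy : IntegrableOn p.y (Set.Icc 0 p.T)) {δ : ℝ} (hδ : 0 < δ)
    (hU₀ : ∀ ξ : Θ, δ * ‖ξ‖ ^ 2 ≤ RCLike.re (inner 𝕜 ξ (p.U₀ ξ)))
    {β : ℝ → Θ →L[𝕜] X} {m : ℝ} (hβ : IsStrongFamily β m)
    (hβB : ∀ t ∈ Set.Icc 0 p.T, ∀ η, β t η = ∫ s in (0 : ℝ)..t, p.S.op (-s) (p.B s η))
    {ζ : X} {θ : Θ} (hne : NormalEquations p.stateResponse β p.T p.U₀ p.θ₀ p.y ζ θ)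
    {κ : ℕ → ℝ} {ζinit : X} {θinit : Θ} (r : p.Run κ ζinit θinit) (j : ℕ) :
    ∃ (ε η : ℝ → X) (P : ℝ → Θ → X), IsIterationError p.stateResponse β p.T
      (fun t => p.y t - p.stateResponse t (ζ + β t θ)) p.U₀ (κ (j + 1))
      (r.zMinus j p.T - ζ) (r.zMinus (j + 1) p.T - ζ) (r.θ (j + 2) - θ) ε η P := by
  have hj : 1 ≤ j + 1 := by omega
  have hD := p.isObservedFamily_stateResponse hS
  have hS1 := p.S.norm_op_le hS
  have h0m : (0 : ℝ) ∈ Set.Icc 0 p.T := ⟨le_rfl, hT⟩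
  have hTm : p.T ∈ Set.Icc 0 p.T := ⟨hT, le_rfl⟩
  set D := p.stateResponse with hDdef
  set k : 𝕜 := ((κ (j + 1) : ℝ) : 𝕜) with hk
  set zP := r.zPlus (j + 1) with hzP
  set zM := r.zMinus (j + 1) with hzM
  set Q := r.sens (j + 1) with hQ
  set Δ := r.θ (j + 2) - r.θ (j + 1) with hΔ
  have hfor : IsMildSolution p.S.op p.T (fun t => k • p.C.adjoint (p.y t - p.C (zP t)) +
      p.B t (r.θ (j + 1))) (r.zMinus j p.T) zP := r.forward (j + 1) hj
  -- The sensitivity is an observer with zero data and zero initial value, so `moving_frame_eq`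
  -- covers it as well.
  have hsens : ∀ ν : Θ, IsMildSolution p.S.op p.T
      (fun t => k • p.C.adjoint (0 - p.C (Q t ν)) + p.B t ν) 0 (fun t => Q t ν) := fun ν => by
    simp only [zero_sub, map_neg, smul_neg]
    exact r.sensitivity (j + 1) hj ν
  have hQc : ∀ ν, ContinuousOn (fun t => Q t ν) (Set.Icc 0 p.T) := fun ν => (hsens ν).1
  have hCz : ∀ {u : ℝ → X}, ContinuousOn u (Set.Icc 0 p.T) →
      IntegrableOn (fun t => p.C (u t)) (Set.Icc 0 p.T) := fun hu =>
    (p.C.continuous.comp_continuousOn hu).integrableOn_Icc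
  have hCQ : ∀ ν, IntegrableOn (fun t => 0 - p.C (Q t ν)) (Set.Icc 0 p.T) := fun ν =>
    integrableOn_zero.sub (hCz (hQc ν))
  have hyz : IntegrableOn (fun t => p.y t - p.C (zP t)) (Set.Icc 0 p.T) := hy.sub (hCz hfor.1)
  have hzMc : ContinuousOn zM (Set.Icc 0 p.T) := (r.backward (j + 1) hj).1
  have hzMr : ContinuousOn (fun s => zM (p.T - s)) (Set.Icc 0 p.T) :=
    hzMc.comp (by fun_prop) fun s hs => ⟨by linarith [hs.2], by linarith [hs.1]⟩
  have hyM : IntegrableOn (fun t => p.y t - p.C (zM (p.T - t))) (Set.Icc 0 p.T) :=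
    hy.sub (hCz hzMr)
  have hbac : IsMildSolution (fun t => p.S.op (-t)) p.T
      (fun t => k • p.C.adjoint ((fun s => p.y s - p.C (zM (p.T - s))) (p.T - t)) -
        (fun s => p.B s (r.θ (j + 2))) (p.T - t)) (zP p.T + Q p.T Δ) zM := by
    simp only [sub_sub_cancel]
    exact r.backward (j + 1) hj
  -- the trajectories in the moving frame
  have hfor' := fun t ht => p.S.moving_frame_eq hS hT _ _ hyz
    (integrableOn_apply_vector hB _) hfor (t := t) ht
  have hsens' := fun ν t ht => p.S.moving_frame_eq hS hT _ _ (hCQ ν)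
    (integrableOn_apply_vector hB _) (hsens ν) (t := t) ht
  have hbac' := fun s hs => p.S.moving_frame_backward_eq hS hT _ _ hyM
    (integrableOn_apply_vector hB _) hbac (s := s) hs
  have hβsub : ∀ s ∈ Set.Icc 0 p.T, ∀ η, ∫ σ in s..p.T, p.S.op (-σ) (p.B σ η) =
      β p.T η - β s η := by
    intro s hs η
    have hi := p.S.integrableOn_op_neg hS (integrableOn_apply_vector hB η)
    rw [hβB _ hTm, hβB _ hs, intervalIntegral.integral_interval_sub_left
      (intervalIntegrable_of_mem_Icc hi h0m hTm) (intervalIntegrable_of_mem_Icc hi h0m hs)]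
  simp only [← p.adjoint_stateResponse hS, ← hDdef] at hfor' hsens' hbac'
  have hDneg : ∀ t x, D t (p.S.op (-t) x) = p.C x := p.stateResponse_op_neg
  -- By linearity zP + QΔ is the forward observer driven by the updated parameter `r.θ (j + 2)`.
  -- This is why the error equations contain only the new parameter error.
  set ε : ℝ → X := fun t => p.S.op (-t) (zP t) + p.S.op (-t) (Q t Δ) - (ζ + β t θ) with hε
  set η : ℝ → X := fun t => p.S.op (-t) (zM (p.T - t)) - (ζ + β t θ) with hη
  set P : ℝ → Θ → X := fun t ν => p.S.op (-t) (Q t ν) with hP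
  have hop : ∀ {u : ℝ → X}, ContinuousOn u (Set.Icc 0 p.T) →
      ContinuousOn (fun t => p.S.op (-t) (u t)) (Set.Icc 0 p.T) := fun hu =>
    hu.strong_apply p.S.reverse.continuous_orbit fun t => hS1 (-t)
  have hstate : ContinuousOn (fun t => ζ + β t θ) (Set.Icc 0 p.T) :=
    (continuous_const.add (hβ.cont θ)).continuousOn
  have hresε : ∀ s, p.y s - D s (ζ + β s θ) - D s (ε s) =
      (p.y s - p.C (zP s)) + (0 - p.C (Q s Δ)) := by
    intro s
    simp only [hε, map_sub, map_add, hDneg]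
    abel
  have hresη : ∀ s, p.y s - D s (ζ + β s θ) - D s (η s) = p.y s - p.C (zM (p.T - s)) := by
    intro s
    simp only [hη, map_sub, map_add, hDneg]
    abel
  have hadj : ∀ {g : ℝ → Y}, IntegrableOn g (Set.Icc 0 p.T) → ∀ t ∈ Set.Icc 0 p.T,
      IntervalIntegrable (fun s => (D s).adjoint (g s)) volume 0 t := fun hg t ht =>
    intervalIntegrable_of_mem_Icc (integrable_strong_apply hD.cont_adjoint
      (fun t => (LinearIsometryEquiv.norm_map _ _).trans_le (hD.norm_le t)) hg) h0m ht
  have hεeq : ∀ t ∈ Set.Icc 0 p.T, ε t = r.zMinus j p.T - ζ + β t (r.θ (j + 2) - θ) +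
      k • ∫ s in (0 : ℝ)..t, (D s).adjoint (p.y s - D s (ζ + β s θ) - D s (ε s)) := by
    intro t ht
    simp only [hresε]
    simp only [map_add (ContinuousLinearMap.adjoint (D _))]
    rw [intervalIntegral.integral_add (hadj hyz t ht) (hadj (hCQ Δ) t ht)]
    have h1 := hfor' t ht
    have h2 := hsens' Δ t ht
    rw [← hβB t ht] at h1 h2
    have h3 : β t (r.θ (j + 2) - θ) = β t (r.θ (j + 1)) + β t Δ - β t θ := by
      rw [hΔ, ← map_add, ← map_sub]; congr 1; abel
    simp only [hε]
    rw [h1, h2, h3, smul_add]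
    abel
  refine ⟨ε, η, P, ⟨((hop hfor.1).add (hop (hQc Δ))).sub hstate, hεeq,
    (hop hzMr).sub hstate, ?_, fun ν => hop (hQc ν), ?_, ?_, ?_⟩⟩
  · intro t ht
    rw [← hk]
    have h1 := hbac' t ht
    rw [hβsub t ht] at h1
    have h2 := hεeq p.T hTm
    -- The corrected initial value of the backward sweep is the endpoint of the corrected forward
    -- trajectory, so the half-sweeps join without a jump.
    have h3 : p.S.op (-p.T) (zP p.T + Q p.T Δ) = ε p.T + (ζ + β p.T θ) := by
      simp only [hε, map_add]; abel
    have h4 : η t = p.S.op (-t) (zM (p.T - t)) - (ζ + β t θ) := rfl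
    simp only [hresη]
    rw [h4, h1, h3, h2]
    simp only [map_sub]
    abel
  · intro ν t ht
    have h2 := hsens' ν t ht
    rw [← hβB t ht, zero_add, add_comm] at h2
    simp only [hP, hDneg]
    exact h2
  · have hstep := r.θ_step (j + 1) hj
    set U := r.U (j + 1) p.T with hU
    have hUeq : ∀ η η' : Θ, inner 𝕜 η (U η') = inner 𝕜 η (p.U₀ η') +
        ∫ s in (0 : ℝ)..p.T, inner 𝕜 (p.C (Q s η)) (p.C (Q s η')) :=
      r.U_eq (j + 1) hj p.T hTm
    have hξeq : ∀ η : Θ, inner 𝕜 η (r.ξ (j + 1) p.T) =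
        ∫ s in (0 : ℝ)..p.T, inner 𝕜 (p.C (Q s η)) (p.y s - p.C (zP s)) :=
      r.ξ_eq (j + 1) hj p.T hTm
    -- U(T) ≥ U₀ ≥ δ in the sense of forms, so `inverse` is a true inverse and not its default value
    -- 0.
    have hunit : IsUnit U := by
      refine U.isUnit_of_forall_le_norm_inner_map (c := ⟨δ, hδ.le⟩) hδ fun ν => ?_
      rw [norm_inner_symm, mul_comm]
      refine le_trans ?_ (RCLike.re_le_norm _)
      rw [hUeq, map_add, re_integral_inner_self hT]
      have h1 : 0 ≤ ∫ s in (0 : ℝ)..p.T, ‖p.C (Q s ν)‖ ^ 2 :=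
        intervalIntegral.integral_nonneg hT fun _ _ => by positivity
      exact (hU₀ ν).trans (le_add_of_nonneg_right h1)
    -- Moving the Gramian part of U Δ to the right turns the update into a normal equation for the
    -- new parameter, with output y - C(zP + QΔ) and sensitivity Q; subtracting the exact normal
    -- equation gives `param`.
    have hUΔ : U Δ = r.ξ (j + 1) p.T - p.U₀ (r.θ (j + 1) - p.θ₀) := by
      have h1 : Δ = -U.inverse (p.U₀ (r.θ (j + 1) - p.θ₀) - r.ξ (j + 1) p.T) := by
        rw [hΔ, show j + 2 = j + 1 + 1 from rfl, hstep]; abel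
      have h2 := DFunLike.congr_fun (Ring.mul_inverse_cancel U hunit)
        (p.U₀ (r.θ (j + 1) - p.θ₀) - r.ξ (j + 1) p.T)
      rw [ContinuousLinearMap.ringInverse_eq_inverse] at h2
      have h3 : U (U.inverse (p.U₀ (r.θ (j + 1) - p.θ₀) - r.ξ (j + 1) p.T)) =
        p.U₀ (r.θ (j + 1) - p.θ₀) - r.ξ (j + 1) p.T := h2
      rw [h1, map_neg, h3, neg_sub]
    set φ := r.θ (j + 2) - θ with hφ
    have hCc : ContinuousOn (fun s => p.C (Q s φ)) (Set.Icc 0 p.T) :=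
      p.C.continuous.comp_continuousOn (hQc φ)
    have hsplit : ∫ s in (0 : ℝ)..p.T,
        inner 𝕜 (D s (P s φ)) (p.y s - D s (ζ + β s θ) - D s (ε s)) =
        (∫ s in (0 : ℝ)..p.T, inner 𝕜 (p.C (Q s φ)) (p.y s - p.C (zP s))) -
          ∫ s in (0 : ℝ)..p.T, inner 𝕜 (p.C (Q s φ)) (p.C (Q s Δ)) := by
      rw [← intervalIntegral.integral_sub
        (intervalIntegrable_inner_of_continuousOn hCc hyz h0m hTm)
        (intervalIntegrable_inner_of_continuousOn hCc (hCz (hQc Δ)) h0m hTm)]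
      simp only [hresε, hP, hDneg, zero_sub, ← sub_eq_add_neg, inner_sub_right]
    have h1 := hUeq φ Δ
    rw [hUΔ, inner_sub_right, hξeq] at h1
    have h2 := hne.2 φ
    have h3 : p.U₀ φ = p.U₀ Δ + p.U₀ (r.θ (j + 1) - p.θ₀) - p.U₀ (θ - p.θ₀) := by
      rw [← map_add, ← map_sub, hφ, hΔ]; congr 1; abel
    rw [hsplit, h3, inner_sub_right, inner_add_right, h2]
    linear_combination -h1
  · simp only [hη]
    rw [hβB 0 h0m, intervalIntegral.integral_same, neg_zero, C0Group.op_zero_apply, sub_zero,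
      add_zero]

end SourceProblem

/-! ### Minimizer and convergence -/

theorem theorem3p3 {𝕜 X Θ Y : Type*} [RCLike 𝕜]
    [NormedAddCommGroup X] [InnerProductSpace 𝕜 X] [CompleteSpace X]
    [NormedSpace ℝ X] [IsScalarTower ℝ 𝕜 X]
    [NormedAddCommGroup Θ] [InnerProductSpace 𝕜 Θ] [CompleteSpace Θ]
    [NormedAddCommGroup Y] [InnerProductSpace 𝕜 Y] [CompleteSpace Y]
    (p : SourceProblem 𝕜 X Θ Y) (hT : 0 < p.T)
    (hB : MemLp p.B 2 (volume.restrict (Set.Icc 0 p.T)))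
    (hy : MemLp p.y 2 (volume.restrict (Set.Icc 0 p.T)))
    (A : X →ₗ.[𝕜] X) (hgen : p.S.generator = A) (hA : IsSkewAdjointOperator A)
    (hobs : p.ExactlyObservable)
    (hU₀ : IsSelfAdjoint p.U₀) (δ : ℝ) (hδ : 0 < δ)
    (hU₀δ : ∀ ξ : Θ, δ * ‖ξ‖ ^ 2 ≤ RCLike.re (inner 𝕜 ξ (p.U₀ ξ)))
    (κ : ℕ → ℝ) (hκ : ∀ j, 1 ≤ j → 0 ≤ κ j)
    (hκsum : Tendsto (fun n => ∑ j ∈ Finset.Icc 1 n, κ j) atTop atTop)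
    (hκsq : Summable fun j => κ j ^ 2) :
    (∃! q : X × Θ, p.IsMinimizer q.1 q.2) ∧
      ∀ (ζo : X) (θo : Θ), p.IsMinimizer ζo θo →
        ∀ (ζinit : X) (θinit : Θ),
          Nonempty (p.Run κ ζinit θinit) ∧
            ∀ r : p.Run κ ζinit θinit,
              Tendsto (fun j => r.zMinus j p.T) atTop (𝓝 ζo) ∧
                Tendsto r.θ atTop (𝓝 θo) := by
  have hS := p.S.norm_op_of_isSkewAdjoint (hgen ▸ hA)
  have hBi : IntegrableOn p.B (Set.Icc 0 p.T) := hB.integrable (by norm_num)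
  have hyi : IntegrableOn p.y (Set.Icc 0 p.T) := hy.integrable (by norm_num)
  obtain ⟨γ, hγ, hobs⟩ := hobs
  obtain ⟨β, m, hβ, hβB⟩ := p.exists_sourceResponse hS hT.le hBi
  have hD := p.isObservedFamily_stateResponse hS
  obtain ⟨α, hα, hcoer⟩ := exists_coercive hT.le hD hβ hγ hobs hδ hU₀δ
  obtain ⟨ζ, θ, hne⟩ := exists_normalEquations hT.le hD hβ (θ₀ := p.θ₀) hyi hα hcoer
  -- Quadratic growth around the solution of the normal equations gives minimality and uniqueness at
  -- once.
  have hgap : ∀ ζ' θ', p.cost ζ θ + α * (‖ζ' - ζ‖ ^ 2 + ‖θ' - θ‖ ^ 2) ≤ p.cost ζ' θ' := by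
    intro ζ' θ'
    have h1 := hne.cost_add hT.le hD hβ hU₀ hy (ζ' - ζ) (θ' - θ)
    rw [add_sub_cancel, add_sub_cancel] at h1
    rw [p.cost_eq hS hT.le hBi hβ hβB, p.cost_eq hS hT.le hBi hβ hβB, h1]
    linarith [hcoer (ζ' - ζ) (θ' - θ)]
  have hmin : p.IsMinimizer ζ θ := fun ζ' θ' =>
    le_trans (le_add_of_nonneg_right (by positivity)) (hgap ζ' θ')
  have huniq : ∀ ζ' θ', p.IsMinimizer ζ' θ' → ζ' = ζ ∧ θ' = θ := by
    intro ζ' θ' h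
    have h1 := (hgap ζ' θ').trans (h ζ θ)
    have h2 : ‖ζ' - ζ‖ ^ 2 + ‖θ' - θ‖ ^ 2 ≤ 0 := by
      by_contra hpos
      have := mul_pos hα (not_le.1 hpos)
      linarith
    have h3 : ‖ζ' - ζ‖ ^ 2 = 0 := by nlinarith [sq_nonneg ‖ζ' - ζ‖, sq_nonneg ‖θ' - θ‖]
    have h4 : ‖θ' - θ‖ ^ 2 = 0 := by nlinarith [sq_nonneg ‖ζ' - ζ‖, sq_nonneg ‖θ' - θ‖]
    exact ⟨sub_eq_zero.1 (by simpa using h3), sub_eq_zero.1 (by simpa using h4)⟩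
  refine ⟨⟨(ζ, θ), hmin, fun q hq => Prod.ext (huniq _ _ hq).1 (huniq _ _ hq).2⟩, ?_⟩
  intro ζo θo ho ζinit θinit
  obtain ⟨rfl, rfl⟩ := huniq ζo θo ho
  refine ⟨p.nonempty_run hS hT.le hBi hyi κ ζinit θinit, fun r => ?_⟩
  have hβ0 : β 0 = 0 := by
    ext η
    rw [hβB 0 ⟨le_rfl, hT.le⟩, intervalIntegral.integral_same, zero_apply]
  have he : IntegrableOn (fun t => p.y t - p.stateResponse t (ζo + β t θo)) (Set.Icc 0 p.T) :=
    hyi.sub (hD.continuous_response hβ ζo θo).integrableOn_Icc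
  obtain ⟨κ₀, ρ, K, hκ₀, hρ, hK, hest⟩ := exists_iteration_estimate hT.le hD hβ hβ0 he hne.1 hα
    hcoer hδ hU₀δ
  -- Square summability makes the gains eventually smaller than κ₀, so the one-iteration estimate
  -- applies to all but finitely many iterations.
  have hκ0 : Tendsto (fun j => κ (j + 1)) atTop (𝓝 0) := by
    have h1 := hκsq.tendsto_atTop_zero.comp (tendsto_add_atTop_nat 1)
    have h2 := (Real.continuous_sqrt.tendsto 0).comp h1
    rw [Real.sqrt_zero] at h2
    refine h2.congr fun j => ?_
    exact Real.sqrt_sq (hκ (j + 1) (by omega))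
  have hstep : ∀ᶠ j in atTop,
      ‖r.zMinus (j + 1) p.T - ζo‖ ^ 2 ≤
        (1 - ρ * κ (j + 1)) * ‖r.zMinus j p.T - ζo‖ ^ 2 + K * κ (j + 1) ^ 2 ∧
      ‖r.θ (j + 2) - θo‖ ≤ K * (‖r.zMinus j p.T - ζo‖ + κ (j + 1)) := by
    filter_upwards [hκ0.eventually (gt_mem_nhds hκ₀)] with j hj
    obtain ⟨ε, η, P, h⟩ := r.isIterationError hS hT.le hBi hyi hδ hU₀δ hβ hβB hne j
    exact hest _ (hκ _ (by omega)) hj.le _ _ _ _ _ _ h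
  have hsum : Tendsto (fun n => ∑ j ∈ Finset.range n, κ (j + 1)) atTop atTop := by
    refine hκsum.congr fun n => ?_
    rw [Finset.range_eq_Ico, Finset.sum_Ico_add' κ 0 n 1, zero_add]
    rfl
  have hz2 := tendsto_zero_of_contraction (a := fun j => ‖r.zMinus j p.T - ζo‖ ^ 2)
    (κ := fun j => κ (j + 1)) hρ hK (fun n => sq_nonneg _)
    (Eventually.of_forall fun j => hκ _ (by omega)) hsum
    ((summable_nat_add_iff 1).2 hκsq) (hstep.mono fun j h => h.1)
  have hz : Tendsto (fun j => ‖r.zMinus j p.T - ζo‖) atTop (𝓝 0) := by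
    have h2 := (Real.continuous_sqrt.tendsto 0).comp hz2
    rw [Real.sqrt_zero] at h2
    exact h2.congr fun j => Real.sqrt_sq (norm_nonneg _)
  refine ⟨tendsto_iff_norm_sub_tendsto_zero.2 hz, ?_⟩
  -- Iteration j + 1 starts from `zMinus j` and produces `θ (j + 2)`, hence the shift by 2.
  rw [← tendsto_add_atTop_iff_nat 2, tendsto_iff_norm_sub_tendsto_zero]
  refine squeeze_zero' (Eventually.of_forall fun _ => norm_nonneg _) (hstep.mono fun j h => h.2) ?_
  simpa using (hz.add hκ0).const_mul K
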